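/- Let $r>0$. Let $N$ be a Poisson process with intensity $r$ (a counting process with $N(0)=0$ and independent stationary increments, $N(t)$ being Poisson distributed with mean $rt$), and let $W^0,W^1,W^2,\dots$ be independent standard Wiener processes started at $0$, the whole sequence being independent of $N$. Let $\tau_0=0$ and let $\tau_k$ be the time of the $k$-th jump of $N$. The Wiener process under Poissonian resetting to $0$ with intensity $r$ is $X(t)=W^{N(t)}\bigl(t-\tau_{N(t)}\bigr)$, and $$L_r=\sup\{t\in[0,1]: X(t)=0\}$$ is its last zero on $[0,1]$. Write $${}_2\bar F_2(a_1,a_2;b_1,b_2;z)=\frac{1}{\Gamma(b_1)\Gamma(b_2)}\sum_{k=0}^\infty\frac{a_1^{(k)}a_2^{(k)}}{b_1^{(k)}b_2^{(k)}}\frac{z^k}{k!},\qquad x^{(k)}=\prod_{j=0}^{k-1}(x+j),$$ for the regularized generalized hypergeometric function. Then for every $r>0$ all the moments of $L_r$ exist and, for every integer $n\ge 0$, $$\mathbb E[L_r^n]=e^{-r}\left(\frac{\Gamma(\frac12+n)}{\sqrt\pi\,\Gamma(1+n)}+r\,\Gamma(\tfrac32+n)\;{}_2\bar F_2\bigl(1,\tfrac32+n;\tfrac32,2+n;r\bigr)\right).$$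 The mean and the variance of $L_r$ are $$\mathbb E[L_r]=1+\frac{e^{-r}-1}{2r},\qquad \operatorname{Var}(L_r)=\mathbb E[L_r^2]-(\mathbb E[L_r])^2=\frac{2-e^{-r}(1+3r)-e^{-2r}}{4r^2}.$$ Consequently $\mathbb E[L_r]\to\frac12$ as $r\to0^+$, while $\mathbb E[L_r]\to1$ and $\operatorname{Var}(L_r)\to0$ as $r\to\infty$, and $L_r\to1$ in probability as $r\to\infty$; that is, for every $\varepsilon>0$, $\mathbb P(|L_r-1|\ge\varepsilon)\to0$ as $r\to\infty$ (the processes for different $r$ may live on different probability spaces). -/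

import Mathlib

open MeasureTheory ProbabilityTheory Filter Topology
open scoped NNReal

namespace BrownianResetting

/-- `N` is a Poisson process with intensity `r` under `P`: a counting process (almost surely with
nondecreasing, right-continuous, `ℕ`-valued paths) started at `0`, with independent and
stationary increments, such that an increment over an interval of length `t` is Poisson
distributed with mean `r t`. (The subtraction of natural numbers in `hasLaw_increment` is
almost surely not truncated, by monotonicity of the paths.) -/
structure IsPoissonProcess {Ω : Type*} [MeasurableSpace Ω] (N : ℝ≥0 → Ω → ℕ) (r : ℝ≥0)
    (P : Measure Ω) : Prop where
  measurable : ∀ t, Measurable (N t)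
  zero : ∀ᵐ ω ∂P, N 0 ω = 0
  indep : HasIndepIncrements (fun t ω ↦ (N t ω : ℝ)) P
  hasLaw_increment : ∀ s t : ℝ≥0,
    HasLaw (fun ω ↦ N (s + t) ω - N s ω) (poissonMeasure (r * t)) P
  mono : ∀ᵐ ω ∂P, Monotone (fun t ↦ N t ω)
  rightCont : ∀ᵐ ω ∂P, ∀ t : ℝ≥0, ContinuousWithinAt (fun s ↦ N s ω) (Set.Ici t) t

/-- The driving objects of Brownian motion with Poissonian resetting of intensity `r`: a Poisson
process `N` whose jumps are the resetting moments, and a sequence of independent Wiener processes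
`W 0, W 1, …`, one for each interval between consecutive resets, the whole sequence being
independent of `N`. -/
structure IsResettingModel {Ω : Type*} [MeasurableSpace Ω] (W : ℕ → ℝ≥0 → Ω → ℝ)
    (N : ℝ≥0 → Ω → ℕ) (r : ℝ≥0) (P : Measure Ω) : Prop where
  poisson : IsPoissonProcess N r P
  brownian : ∀ k, IsBrownianReal (W k) P
  measurable : ∀ k t, Measurable (W k t)
  iIndep : iIndepFun (fun k ω t ↦ W k t ω) P
  indep : IndepFun (fun ω k t ↦ W k t ω) (fun ω t ↦ N t ω) P

/-- The time of the `k`-th jump of the counting process `N` (equal to `0` for `k = 0`). -/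
noncomputable def jumpTime {Ω : Type*} (N : ℝ≥0 → Ω → ℕ) (k : ℕ) (ω : Ω) : ℝ≥0 :=
  sInf {t : ℝ≥0 | k ≤ N t ω}

/-- The Wiener process under resetting to `0`: at time `t` the time elapsed since the last reset
is `t - jumpTime N (N t ω) ω`, and the process has followed the Wiener process `W (N t ω)`,
started at `0`, since then. -/
noncomputable def resetProcess {Ω : Type*} (W : ℕ → ℝ≥0 → Ω → ℝ) (N : ℝ≥0 → Ω → ℕ)
    (t : ℝ≥0) (ω : Ω) : ℝ :=
  W (N t ω) (t - jumpTime N (N t ω) ω) ω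

/-- The last zero of a process `X` on the time interval `[0, 1]`. -/
noncomputable def lastZero {Ω : Type*} (X : ℝ≥0 → Ω → ℝ) (ω : Ω) : ℝ :=
  ((sSup {t : ℝ≥0 | t ≤ 1 ∧ X t ω = 0} : ℝ≥0) : ℝ)

end BrownianResetting

/-!
Run Brownian motion from `0` at time `a`. By the strong Markov property and reflection, it has a
zero in `[s, u]` with probability `4 ℙ(B_s > 0, B_u < 0)`, a Gaussian wedge probability; this is the
arcsine law for its last zero before time `1`. The last zero of the resetting process is that of the
Brownian motion restarted at the last reset. Given that there are `j` resets, the last one is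
distributed as the maximum of `j` uniform variables, so the last zero has the beta law with
parameters `j + 1 / 2` and `1 / 2`. Unconditionally it is therefore a Poisson mixture of beta laws,
and its moments are `e⁻ʳ ∑ⱼ rʲ Γ(n + j + 1/2) / (Γ(j + 1/2) (n + j)!)`: the term `j = 0` and the
rest of the series are the two summands of the moment formula. The mean tends to the upper bound `1`
of the variable as `r → ∞`, which forces convergence in probability.
-/

namespace BrownianResetting

section Beta

variable {a b : ℝ}

lemma betaPDFReal_nonneg (ha : 0 < a) (hb : 0 < b) (y : ℝ) : 0 ≤ betaPDFReal a b y := by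
  by_cases hy : 0 < y ∧ y < 1
  · exact (betaPDFReal_pos hy.1 hy.2 ha hb).le
  · rw [betaPDFReal, if_neg hy]

lemma measurable_betaPDF (a b : ℝ) : Measurable (betaPDF a b) :=
  (measurable_betaPDFReal a b).ennreal_ofReal

lemma support_betaPDF_subset (a b : ℝ) : (betaPDF a b).support ⊆ Set.Ioo 0 1 := by
  refine Function.support_subset_iff'.2 fun x hx ↦ ?_
  rw [Set.mem_Ioo, not_and_or, not_lt, not_lt] at hx
  exact hx.elim betaPDF_eq_zero_of_nonpos betaPDF_eq_zero_of_one_le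

lemma ae_mem_Ioo_betaMeasure (a b : ℝ) : ∀ᵐ x ∂betaMeasure a b, x ∈ Set.Ioo 0 1 := by
  rw [betaMeasure, ae_withDensity_iff (measurable_betaPDF a b)]
  exact ae_of_all _ fun x hx ↦ support_betaPDF_subset a b hx

lemma integral_betaMeasure (ha : 0 < a) (hb : 0 < b) (f : ℝ → ℝ) :
    ∫ y, f y ∂betaMeasure a b = ∫ y, betaPDFReal a b y * f y := by
  rw [betaMeasure, integral_withDensity_eq_integral_toReal_smul (measurable_betaPDF a b)
    (ae_of_all _ fun _ ↦ ENNReal.ofReal_lt_top)]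
  simp only [betaPDF, ENNReal.toReal_ofReal (betaPDFReal_nonneg ha hb _), smul_eq_mul]

lemma betaPDFReal_mul_pow (ha : 0 < a) (hb : 0 < b) (n : ℕ) (y : ℝ) :
    betaPDFReal a b y * y ^ n = beta (a + n) b / beta a b * betaPDFReal (a + n) b y := by
  unfold betaPDFReal
  split_ifs with hy
  · have := (beta_pos ha hb).ne'
    have := (beta_pos (show 0 < a + n by positivity) hb).ne'
    rw [show a + n - 1 = (a - 1) + n by ring, Real.rpow_add_natCast hy.1.ne']
    field_simp
  · simp only [zero_mul, mul_zero]

lemma integral_pow_betaMeasure (ha : 0 < a) (hb : 0 < b) (n : ℕ) :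
    ∫ y, y ^ n ∂betaMeasure a b = beta (a + n) b / beta a b := by
  have han : 0 < a + n := by positivity
  have := isProbabilityMeasureBeta han hb
  have integral_betaPDFReal : ∫ y, betaPDFReal (a + n) b y = 1 := by
    simpa using (integral_betaMeasure han hb fun _ ↦ 1).symm
  rw [integral_betaMeasure ha hb]
  simp_rw [betaPDFReal_mul_pow ha hb]
  rw [integral_const_mul, integral_betaPDFReal, mul_one]

lemma lintegral_Ioo_rpow_mul_one_sub_rpow (ha : 0 < a) (hb : 0 < b) :
    ∫⁻ x in Set.Ioo (0 : ℝ) 1, ENNReal.ofReal (x ^ (a - 1) * (1 - x) ^ (b - 1)) =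
      ENNReal.ofReal (beta a b) := by
  have hbeta := beta_pos ha hb
  have h := lintegral_betaPDF_eq_one ha hb
  simp_rw [lintegral_betaPDF, mul_assoc, ENNReal.ofReal_mul (one_div_nonneg.2 hbeta.le)] at h
  rwa [lintegral_const_mul' _ _ ENNReal.ofReal_ne_top, one_div, ENNReal.ofReal_inv_of_pos hbeta,
    mul_comm, ← div_eq_mul_inv, ENNReal.div_eq_one_iff (by simpa using hbeta)
      ENNReal.ofReal_ne_top] at h

lemma lintegral_Ioo_rpow_mul_sub_rpow {y : ℝ} (ha : 0 < a) (hb : 0 < b) (hy : 0 < y) :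
    ∫⁻ c in Set.Ioo 0 y, ENNReal.ofReal (c ^ (a - 1) * (y - c) ^ (b - 1)) =
      ENNReal.ofReal (y ^ (a + b - 1) * beta a b) := by
  have himage : (y * ·) '' Set.Ioo 0 1 = Set.Ioo 0 y := by
    rw [Set.image_mul_left_Ioo hy, mul_zero, mul_one]
  have hderiv (x : ℝ) : HasDerivAt (y * ·) y x := by
    simpa using (hasDerivAt_id x).const_mul y
  rw [← himage, lintegral_image_eq_lintegral_abs_deriv_mul measurableSet_Ioo
      (fun x _ ↦ (hderiv x).hasDerivWithinAt) (mul_right_injective₀ hy.ne').injOn,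
    ENNReal.ofReal_mul (by positivity), ← lintegral_Ioo_rpow_mul_one_sub_rpow ha hb,
    ← lintegral_const_mul' _ _ ENNReal.ofReal_ne_top]
  refine setLIntegral_congr_fun measurableSet_Ioo fun x hx ↦ ?_
  rw [← ENNReal.ofReal_mul (abs_nonneg y), ← ENNReal.ofReal_mul (by positivity), abs_of_pos hy,
    show y - y * x = y * (1 - x) by ring, Real.mul_rpow hy.le hx.1.le,
    Real.mul_rpow hy.le (sub_nonneg.2 hx.2.le), show a + b - 1 = 1 + (a - 1) + (b - 1) by ring,
    Real.rpow_add hy, Real.rpow_add hy, Real.rpow_one]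
  ring_nf

lemma beta_one_right (ha : 0 < a) : beta a 1 = 1 / a := by
  have := (Real.Gamma_pos_of_pos ha).ne'
  rw [beta, Real.Gamma_one, Real.Gamma_add_one ha.ne']
  field_simp

lemma betaPDF_one_right {x : ℝ} (ha : 0 < a) (hx : x ∈ Set.Ioo 0 1) :
    betaPDF a 1 x = ENNReal.ofReal (a * x ^ (a - 1)) := by
  rw [betaPDF_of_pos_lt_one hx.1 hx.2, beta_one_right ha, one_div_one_div, sub_self,
    Real.rpow_zero, mul_one]

lemma betaMeasure_one_Iic {t : ℝ} (ha : 0 < a) (ht0 : 0 ≤ t) (ht1 : t ≤ 1) :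
    betaMeasure a 1 (Set.Iic t) = ENNReal.ofReal (t ^ a) := by
  have hdensity : ∫⁻ x in Set.Iic t, betaPDF a 1 x = ∫⁻ x in Set.Ioo 0 t, betaPDF a 1 x := by
    rw [← setLIntegral_eq_of_support_subset (support_betaPDF_subset a 1),
      Measure.restrict_congr_set Iio_ae_eq_Iic.symm, Measure.restrict_restrict measurableSet_Ioo,
      Set.Ioo_inter_Iio, min_eq_right ht1]
  have hpdf : ∀ x ∈ Set.Ioo 0 t, betaPDF a 1 x =
      ENNReal.ofReal a * ENNReal.ofReal (x ^ (a - 1) * (t - x) ^ ((1 : ℝ) - 1)) := by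
    intro x hx
    rw [betaPDF_one_right ha ⟨hx.1, hx.2.trans_le ht1⟩, ENNReal.ofReal_mul ha.le, sub_self,
      Real.rpow_zero, mul_one]
  rcases ht0.eq_or_lt with rfl | ht
  · simp [betaMeasure, hdensity, ha.ne']
  rw [betaMeasure, withDensity_apply _ measurableSet_Iic, hdensity,
    setLIntegral_congr_fun measurableSet_Ioo hpdf, lintegral_const_mul' _ _ ENNReal.ofReal_ne_top,
    lintegral_Ioo_rpow_mul_sub_rpow ha one_pos ht, ← ENNReal.ofReal_mul ha.le, beta_one_right ha,
    add_sub_cancel_right]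
  field_simp

end Beta

section Arcsine

/-- The arcsine distribution on `[a, b]`. The density needs no indicator: `√x = 0` for `x < 0`
and `1 / 0 = 0`, so it vanishes outside `(a, b)`. -/
noncomputable def arcsineMeasure (a b : ℝ) : Measure ℝ :=
  volume.withDensity fun y ↦ ENNReal.ofReal (1 / (Real.pi * √((y - a) * (b - y))))

variable {a b x y : ℝ}

lemma measurable_arcsineMeasure (b : ℝ) : Measurable fun a ↦ arcsineMeasure a b := by
  refine Measure.measurable_of_measurable_coe _ fun s hs ↦ ?_
  simp only [arcsineMeasure, withDensity_apply _ hs]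
  exact Measurable.lintegral_prod_right' (f := fun p : ℝ × ℝ ↦
    ENNReal.ofReal (1 / (Real.pi * √((p.2 - p.1) * (b - p.2))))) (by fun_prop)

lemma support_arcsineDensity_subset (hab : a ≤ b) :
    (fun y ↦ ENNReal.ofReal (1 / (Real.pi * √((y - a) * (b - y))))).support ⊆ Set.Ioo a b := by
  refine Function.support_subset_iff'.2 fun y hy ↦ ?_
  have : (y - a) * (b - y) ≤ 0 := by
    rcases le_or_gt y a with h | h
    · exact mul_nonpos_of_nonpos_of_nonneg (by linarith) (by linarith)
    · exact mul_nonpos_of_nonneg_of_nonpos (by linarith)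
        (sub_nonpos.2 (not_lt.1 fun h' ↦ hy ⟨h, h'⟩))
  rw [Real.sqrt_eq_zero'.2 this, mul_zero, div_zero, ENNReal.ofReal_zero]

lemma hasDerivAt_arcsin_sqrt_div (hy : y ∈ Set.Ioo a b) :
    HasDerivAt (fun y ↦ 2 / Real.pi * Real.arcsin √((y - a) / (b - a)))
      (1 / (Real.pi * √((y - a) * (b - y)))) y := by
  have hya : 0 < y - a := sub_pos.2 hy.1
  have hyb : 0 < b - y := sub_pos.2 hy.2
  have hab : 0 < b - a := by linarith
  have hlt : √((y - a) / (b - a)) < 1 := by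
    rw [Real.sqrt_lt' one_pos, one_pow, div_lt_one hab]
    linarith
  have hpos : 0 < √((y - a) / (b - a)) := by positivity
  convert! ((Real.hasDerivAt_arcsin (by linarith) hlt.ne).comp y
    ((((hasDerivAt_id y).sub_const a).div_const (b - a)).sqrt
      (div_pos hya hab).ne')).const_mul (2 / Real.pi) using 1
  simp only [id]
  rw [Real.sq_sqrt (by positivity),
    show 1 - (y - a) / (b - a) = (b - y) / (b - a) by field_simp; ring,
    Real.sqrt_mul hya.le, Real.sqrt_div hyb.le, Real.sqrt_div hya.le]
  have := Real.sqrt_pos.2 hya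
  have := Real.sqrt_pos.2 hyb
  have := Real.sqrt_pos.2 hab
  field_simp
  rw [Real.sq_sqrt hab.le]

lemma lintegral_Ioo_arcsineDensity (hab : a < b) (hax : a ≤ x) (hxb : x ≤ b) :
    ∫⁻ y in Set.Ioo x b, ENNReal.ofReal (1 / (Real.pi * √((y - a) * (b - y)))) =
      ENNReal.ofReal (1 - 2 / Real.pi * Real.arcsin √((x - a) / (b - a))) := by
  have hcont : ContinuousOn (fun y ↦ 2 / Real.pi * Real.arcsin √((y - a) / (b - a)))
      (Set.Icc x b) := by
    fun_prop
  have hderiv : ∀ y ∈ Set.Ioo x b, HasDerivAt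
      (fun y ↦ 2 / Real.pi * Real.arcsin √((y - a) / (b - a)))
      (1 / (Real.pi * √((y - a) * (b - y)))) y :=
    fun y hy ↦ hasDerivAt_arcsin_sqrt_div ⟨hax.trans_lt hy.1, hy.2⟩
  have hint := intervalIntegral.integrableOn_deriv_of_nonneg hcont hderiv
    fun y _ ↦ by positivity
  rw [restrict_Ioo_eq_restrict_Ioc, ← ofReal_integral_eq_lintegral_ofReal hint
    (ae_of_all _ fun y ↦ by positivity), ← intervalIntegral.integral_of_le hxb,
    intervalIntegral.integral_eq_sub_of_hasDerivAt_of_le hxb hcont hderiv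
      ((intervalIntegrable_iff_integrableOn_Ioc_of_le hxb).2 hint),
    div_self (sub_pos.2 hab).ne', Real.sqrt_one, Real.arcsin_one,
    div_mul_div_cancel₀ Real.pi_ne_zero, div_self two_ne_zero]

-- For `x < a` both sides equal `1`, as then `√((x - a) / (b - a)) = 0`.
lemma arcsineMeasure_Ici (hab : a < b) (hxb : x ≤ b) :
    arcsineMeasure a b (Set.Ici x) =
      ENNReal.ofReal (1 - 2 / Real.pi * Real.arcsin √((x - a) / (b - a))) := by
  have hmax : √((max x a - a) / (b - a)) = √((x - a) / (b - a)) := by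
    rcases le_total a x with h | h
    · rw [max_eq_left h]
    · rw [max_eq_right h, sub_self, zero_div, Real.sqrt_zero, Real.sqrt_eq_zero'.2
        (div_nonpos_of_nonpos_of_nonneg (sub_nonpos.2 h) (sub_nonneg.2 hab.le))]
  rw [arcsineMeasure, withDensity_apply _ measurableSet_Ici,
    ← setLIntegral_eq_of_support_subset (support_arcsineDensity_subset hab.le),
    Measure.restrict_congr_set Ioi_ae_eq_Ici.symm, Measure.restrict_restrict measurableSet_Ioo,
    Set.Ioo_inter_Ioi, max_comm,
    lintegral_Ioo_arcsineDensity hab (le_max_right x a) (max_le hxb hab.le), hmax]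

lemma one_div_pi_mul_sqrt_mul (hx : 0 ≤ x) (hy : 0 ≤ y) :
    1 / (Real.pi * √(x * y)) =
      1 / Real.pi * (x ^ ((1 / 2 : ℝ) - 1) * y ^ ((1 / 2 : ℝ) - 1)) := by
  rw [Real.sqrt_mul hx, show (1 / 2 : ℝ) - 1 = -(1 / 2) by norm_num, Real.rpow_neg hx,
    Real.rpow_neg hy, ← Real.sqrt_eq_rpow, ← Real.sqrt_eq_rpow]
  field_simp

lemma arcsineMeasure_zero_one : arcsineMeasure 0 1 = betaMeasure (1 / 2) (1 / 2) := by
  have hbeta : beta (1 / 2) (1 / 2) = Real.pi := by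
    rw [beta, Real.Gamma_one_half_eq, add_halves, Real.Gamma_one, div_one,
      Real.mul_self_sqrt Real.pi_nonneg]
  refine congrArg volume.withDensity (funext fun y ↦ ?_)
  by_cases hy : y ∈ Set.Ioo 0 1
  · rw [betaPDF_of_pos_lt_one hy.1 hy.2, hbeta, sub_zero,
      one_div_pi_mul_sqrt_mul hy.1.le (sub_nonneg.2 hy.2.le), mul_assoc]
  · rw [Function.support_subset_iff'.1 (support_arcsineDensity_subset zero_le_one) y hy,
      Function.support_subset_iff'.1 (support_betaPDF_subset _ _) y hy]

lemma beta_mul_beta_add_half (ha : 0 < a) :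
    a * beta a (1 / 2) * beta (a + 1 / 2) (1 / 2) = Real.pi := by
  have := (Real.Gamma_pos_of_pos ha).ne'
  have := (Real.Gamma_pos_of_pos (show 0 < a + 1 / 2 by positivity)).ne'
  rw [beta, beta, add_assoc, add_halves, Real.Gamma_add_one ha.ne', Real.Gamma_one_half_eq]
  field_simp
  rw [Real.sq_sqrt Real.pi_nonneg]

lemma lt_and_lt_of_betaPDF_mul_arcsineDensity_ne_zero {c : ℝ} (h : betaPDF a 1 c *
    ENNReal.ofReal (1 / (Real.pi * √((y - c) * (1 - y)))) ≠ 0) : 0 < c ∧ c < y ∧ y < 1 := by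
  have hne := mul_ne_zero_iff.1 h
  have hc := support_betaPDF_subset a 1 hne.1
  exact ⟨hc.1, support_arcsineDensity_subset hc.2.le hne.2⟩

lemma lintegral_betaPDF_mul_arcsineDensity (ha : 0 < a) (y : ℝ) :
    ∫⁻ c, betaPDF a 1 c * ENNReal.ofReal (1 / (Real.pi * √((y - c) * (1 - y)))) =
      betaPDF (a + 1 / 2) (1 / 2) y := by
  by_cases hy : y ∈ Set.Ioo 0 1
  · have hy1 : 0 < 1 - y := sub_pos.2 hy.2
    have hdensity : ∀ c ∈ Set.Ioo 0 y,
        betaPDF a 1 c * ENNReal.ofReal (1 / (Real.pi * √((y - c) * (1 - y)))) =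
          ENNReal.ofReal (a / Real.pi * (1 - y) ^ ((1 / 2 : ℝ) - 1)) *
            ENNReal.ofReal (c ^ (a - 1) * (y - c) ^ ((1 / 2 : ℝ) - 1)) := by
      intro c hc
      have hc0 := hc.1
      rw [betaPDF_one_right ha ⟨hc.1, hc.2.trans hy.2⟩,
        one_div_pi_mul_sqrt_mul (sub_nonneg.2 hc.2.le) hy1.le,
        ← ENNReal.ofReal_mul (by positivity), ← ENNReal.ofReal_mul (by positivity)]
      ring_nf
    have hsupport : (fun c ↦ betaPDF a 1 c *
        ENNReal.ofReal (1 / (Real.pi * √((y - c) * (1 - y))))).support ⊆ Set.Ioo 0 y := fun c hc ↦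
      have h := lt_and_lt_of_betaPDF_mul_arcsineDensity_ne_zero hc
      ⟨h.1, h.2.1⟩
    rw [← setLIntegral_eq_of_support_subset hsupport,
      setLIntegral_congr_fun measurableSet_Ioo hdensity,
      lintegral_const_mul' _ _ ENNReal.ofReal_ne_top,
      lintegral_Ioo_rpow_mul_sub_rpow ha one_half_pos hy.1, ← ENNReal.ofReal_mul (by positivity),
      betaPDF_of_pos_lt_one hy.1 hy.2, ← beta_mul_beta_add_half ha]
    have := (beta_pos ha one_half_pos).ne'
    have := (beta_pos (show 0 < a + 1 / 2 by positivity) one_half_pos).ne'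
    field_simp
  · rw [Function.support_subset_iff'.1 (support_betaPDF_subset _ _) y hy]
    refine lintegral_eq_zero_of_ae_eq_zero (ae_of_all _ fun c ↦ by_contra fun hc ↦ hy ?_)
    have h := lt_and_lt_of_betaPDF_mul_arcsineDensity_ne_zero hc
    exact ⟨h.1.trans h.2.1, h.2.2⟩

lemma bind_betaMeasure_arcsineMeasure (ha : 0 < a) :
    (betaMeasure a 1).bind (arcsineMeasure · 1) = betaMeasure (a + 1 / 2) (1 / 2) := by
  ext s hs
  have hmeas : Measurable fun p : ℝ × ℝ ↦ betaPDF a 1 p.1 *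
      ENNReal.ofReal (1 / (Real.pi * √((p.2 - p.1) * (1 - p.2)))) :=
    ((measurable_betaPDF a 1).comp measurable_fst).mul (by fun_prop)
  have hmeas_coe : Measurable fun c ↦ arcsineMeasure c 1 s :=
    (Measure.measurable_coe hs).comp (measurable_arcsineMeasure 1)
  rw [Measure.bind_apply hs (measurable_arcsineMeasure 1).aemeasurable, betaMeasure, betaMeasure,
    withDensity_apply _ hs, lintegral_withDensity_eq_lintegral_mul _ (measurable_betaPDF a 1)
      hmeas_coe]
  simp only [Pi.mul_apply, arcsineMeasure, withDensity_apply _ hs]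
  calc ∫⁻ c, betaPDF a 1 c * ∫⁻ y in s, ENNReal.ofReal (1 / (Real.pi * √((y - c) * (1 - y))))
      = ∫⁻ c, ∫⁻ y in s,
          betaPDF a 1 c * ENNReal.ofReal (1 / (Real.pi * √((y - c) * (1 - y)))) := by
        exact lintegral_congr fun c ↦ (lintegral_const_mul' _ _ ENNReal.ofReal_ne_top).symm
    _ = ∫⁻ y in s, ∫⁻ c,
          betaPDF a 1 c * ENNReal.ofReal (1 / (Real.pi * √((y - c) * (1 - y)))) :=
        lintegral_lintegral_swap hmeas.aemeasurable
    _ = ∫⁻ y in s, betaPDF (a + 1 / 2) (1 / 2) y := by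
        simp_rw [lintegral_betaPDF_mul_arcsineDensity ha]

end Arcsine

section GaussianWedge

lemma lintegral_Ioi_mul_exp_neg_mul_sq {b : ℝ} (hb : 0 < b) :
    ∫⁻ x in Set.Ioi (0 : ℝ), ENNReal.ofReal (x * Real.exp (-b * x ^ 2)) =
      ENNReal.ofReal (1 / (2 * b)) := by
  have hderiv : ∀ x ∈ Set.Ici (0 : ℝ),
      HasDerivAt (fun x ↦ -(1 / (2 * b)) * Real.exp (-b * x ^ 2))
        (x * Real.exp (-b * x ^ 2)) x := by
    intro x _
    convert! (((hasDerivAt_pow 2 x).const_mul (-b)).exp).const_mul (-(1 / (2 * b))) using 1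
    field_simp
    norm_num [mul_comm]
  have hlim : Tendsto (fun x : ℝ ↦ -(1 / (2 * b)) * Real.exp (-b * x ^ 2)) atTop (𝓝 0) := by
    have : Tendsto (fun x : ℝ ↦ -b * x ^ 2) atTop atBot :=
      (tendsto_pow_atTop two_ne_zero).const_mul_atTop_of_neg (neg_neg_of_pos hb)
    simpa using (Real.tendsto_exp_atBot.comp this).const_mul (-(1 / (2 * b)))
  have hnonneg : ∀ x ∈ Set.Ioi (0 : ℝ), 0 ≤ x * Real.exp (-b * x ^ 2) :=
    fun x hx ↦ mul_nonneg (le_of_lt hx) (Real.exp_nonneg _)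
  rw [← ofReal_integral_eq_lintegral_ofReal
      (integrableOn_Ioi_deriv_of_nonneg' hderiv hnonneg hlim)
      ((ae_restrict_iff' measurableSet_Ioi).2 (ae_of_all _ hnonneg)),
    integral_Ioi_of_hasDerivAt_of_nonneg' hderiv hnonneg hlim]
  simp

lemma gaussianPDF_mul_gaussianReal_Ioi (c : ℝ) {x : ℝ} (hx : 0 < x) :
    gaussianPDF 0 1 x * gaussianReal 0 1 (Set.Ioi (x * c)) =
      ∫⁻ w in Set.Ioi c, ENNReal.ofReal (1 / (2 * Real.pi)) *
        ENNReal.ofReal (x * Real.exp (-((1 + w ^ 2) / 2) * x ^ 2)) := by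
  have hderiv (w : ℝ) : HasDerivAt (x * ·) x w := by
    simpa using (hasDerivAt_id w).const_mul x
  rw [gaussianReal_apply _ one_ne_zero, ← Set.image_mul_left_Ioi hx,
    lintegral_image_eq_lintegral_abs_deriv_mul measurableSet_Ioi
      (fun w _ ↦ (hderiv w).hasDerivWithinAt) (mul_right_injective₀ hx.ne').injOn,
    gaussianPDF, ← lintegral_const_mul' _ _ ENNReal.ofReal_ne_top]
  refine lintegral_congr fun w ↦ ?_
  rw [gaussianPDF, ← ENNReal.ofReal_mul (abs_nonneg x),
    ← ENNReal.ofReal_mul (gaussianPDFReal_nonneg _ _ _), ← ENNReal.ofReal_mul (by positivity)]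
  simp only [gaussianPDFReal, sub_zero, abs_of_pos hx, NNReal.coe_one, mul_one]
  rw [show -((1 + w ^ 2) / 2) * x ^ 2 = -x ^ 2 / 2 + -(x * w) ^ 2 / 2 by ring, Real.exp_add]
  congr 1
  field_simp
  rw [Real.sq_sqrt (by positivity)]

lemma lintegral_Ioi_inv_one_add_sq (c : ℝ) :
    ∫⁻ w in Set.Ioi c, ENNReal.ofReal ((1 + w ^ 2)⁻¹) =
      ENNReal.ofReal (Real.pi / 2 - Real.arctan c) := by
  rw [← integral_Ioi_inv_one_add_sq, ofReal_integral_eq_lintegral_ofReal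
    integrable_inv_one_add_sq.integrableOn (ae_of_all _ fun x ↦ by positivity)]

lemma lintegral_Ioi_gaussianReal_Ioi (c : ℝ) :
    ∫⁻ x in Set.Ioi 0, gaussianReal 0 1 (Set.Ioi (x * c)) ∂gaussianReal 0 1 =
      ENNReal.ofReal ((Real.pi / 2 - Real.arctan c) / (2 * Real.pi)) := by
  have hmeas : Measurable fun x : ℝ ↦ gaussianReal 0 1 (Set.Ioi (x * c)) :=
    measurable_measure_prodMk_left (s := {p : ℝ × ℝ | p.1 * c < p.2})
      (measurableSet_lt (by fun_prop) (by fun_prop))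
  have hradial (w : ℝ) : ∫⁻ x in Set.Ioi (0 : ℝ), ENNReal.ofReal (1 / (2 * Real.pi)) *
      ENNReal.ofReal (x * Real.exp (-((1 + w ^ 2) / 2) * x ^ 2)) =
        ENNReal.ofReal (1 / (2 * Real.pi)) * ENNReal.ofReal ((1 + w ^ 2)⁻¹) := by
    rw [lintegral_const_mul' _ _ ENNReal.ofReal_ne_top,
      lintegral_Ioi_mul_exp_neg_mul_sq (by positivity)]
    field_simp
  rw [gaussianReal_of_var_ne_zero _ one_ne_zero,
    setLIntegral_withDensity_eq_setLIntegral_mul _ (measurable_gaussianPDF _ _)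
      (gaussianReal_of_var_ne_zero 0 one_ne_zero ▸ hmeas) measurableSet_Ioi,
    ← gaussianReal_of_var_ne_zero _ one_ne_zero]
  simp only [Pi.mul_apply]
  rw [setLIntegral_congr_fun measurableSet_Ioi fun x hx ↦ gaussianPDF_mul_gaussianReal_Ioi c hx,
    lintegral_lintegral_swap (by fun_prop)]
  simp_rw [hradial]
  rw [lintegral_const_mul' _ _ ENNReal.ofReal_ne_top, lintegral_Ioi_inv_one_add_sq,
    ← ENNReal.ofReal_mul (by positivity)]
  ring_nf

lemma gaussianReal_prod_pos_mul_lt (c : ℝ) :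
    (gaussianReal 0 1).prod (gaussianReal 0 1) {p | 0 < p.1 ∧ p.1 * c < p.2} =
      ENNReal.ofReal ((Real.pi / 2 - Real.arctan c) / (2 * Real.pi)) := by
  have hmeas : MeasurableSet {p : ℝ × ℝ | 0 < p.1 ∧ p.1 * c < p.2} :=
    (measurableSet_lt measurable_const measurable_fst).inter
      (measurableSet_lt (measurable_fst.mul_const c) measurable_snd)
  rw [Measure.prod_apply hmeas, ← lintegral_Ioi_gaussianReal_Ioi,
    ← lintegral_indicator measurableSet_Ioi]
  refine lintegral_congr fun x ↦ ?_
  by_cases hx : 0 < x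
  · simp only [Set.indicator_of_mem (Set.mem_Ioi.2 hx), Set.preimage_ofPred_eq, hx, true_and]
    rfl
  · simp [hx]

lemma gaussianReal_prod_pos_lt {v w : ℝ≥0} (hw : w ≠ 0) (hv : v ≠ 0) :
    (gaussianReal 0 v).prod (gaussianReal 0 w) {p | 0 < p.1 ∧ p.1 < p.2} =
      ENNReal.ofReal ((Real.pi / 2 - Real.arctan √(v / w)) / (2 * Real.pi)) := by
  have hscale (v : ℝ≥0) : gaussianReal 0 v = (gaussianReal 0 1).map (√v * ·) := by
    rw [gaussianReal_map_const_mul, mul_zero, mul_one]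
    congr 1
    ext
    exact (Real.sq_sqrt v.coe_nonneg).symm
  have hv' : 0 < √(v : ℝ) := Real.sqrt_pos.2 (by positivity)
  have hw' : 0 < √(w : ℝ) := Real.sqrt_pos.2 (by positivity)
  have hmeas : MeasurableSet {p : ℝ × ℝ | 0 < p.1 ∧ p.1 < p.2} :=
    (measurableSet_lt measurable_const measurable_fst).inter
      (measurableSet_lt measurable_fst measurable_snd)
  rw [hscale v, hscale w, Measure.map_prod_map _ _ (by fun_prop) (by fun_prop),
    Measure.map_apply (by fun_prop) hmeas, ← gaussianReal_prod_pos_mul_lt]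
  congr 1
  ext p
  simp only [Set.mem_preimage, Set.mem_ofPred_eq, Prod.map_fst, Prod.map_snd,
    mul_pos_iff_of_pos_left hv']
  rw [Real.sqrt_div v.coe_nonneg, mul_div_assoc', div_lt_iff₀ hw', mul_comm p.1, mul_comm p.2]

end GaussianWedge

section ZeroSet

open TopologicalSpace (denseSeq denseRange_denseSeq)

/-- The path `w` approaches `0` on `[q, u]` along the countable set `denseSeq ℝ≥0`, with the
endpoint `q` relaxed so that `q = u` is allowed. For continuous paths this means that `w` has a
zero on `[q, u]`, but it is measurable jointly in `q`, `u` and `w`, and depends only on the path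
up to time `u`. -/
def ApproachesZeroOn (w : ℝ≥0 → ℝ) (q u : ℝ≥0) : Prop :=
  ∀ m : ℕ, ∃ k, denseSeq ℝ≥0 k ≤ u ∧ q < denseSeq ℝ≥0 k + 1 / (m + 1) ∧
    |w (denseSeq ℝ≥0 k)| < 1 / (m + 1)

lemma approachesZeroOn_iff_exists {w : ℝ≥0 → ℝ} (hw : Continuous w) {q u : ℝ≥0} (hu : u ≠ 0) :
    ApproachesZeroOn w q u ↔ ∃ t ∈ Set.Icc q u, w t = 0 := by
  constructor
  · intro h
    obtain ⟨t, ht, hmin⟩ := (isCompact_Icc (a := 0) (b := u)).exists_isMinOn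
      (Set.nonempty_Icc.2 zero_le)
      (f := fun t : ℝ≥0 ↦ max |w t| ((q : ℝ) - t)) (by fun_prop)
    have hle : max |w t| ((q : ℝ) - t) ≤ 0 := by
      refine ge_of_tendsto' tendsto_one_div_add_atTop_nhds_zero_nat fun m ↦ ?_
      obtain ⟨k, hku, hqk, hwk⟩ := h m
      refine (hmin ⟨zero_le, hku⟩).trans (max_le hwk.le (sub_le_iff_le_add'.2 ?_))
      exact_mod_cast hqk.le
    obtain ⟨hwt, hqt⟩ := max_le_iff.1 hle
    exact ⟨t, ⟨NNReal.coe_le_coe.1 (sub_nonpos.1 hqt), ht.2⟩, abs_nonpos_iff.1 hwt⟩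
  · rintro ⟨t, ht, hwt⟩ m
    have hopen : IsOpen {v | q < v + 1 / (m + 1) ∧ |w v| < 1 / (m + 1)} :=
      (isOpen_lt continuous_const (by fun_prop)).inter (isOpen_lt hw.abs continuous_const)
    have hmem : t ∈ {v | q < v + 1 / (m + 1) ∧ |w v| < 1 / (m + 1)} :=
      ⟨ht.1.trans_lt (lt_add_of_pos_right t (by positivity)), by rw [hwt, abs_zero]; positivity⟩
    have hclosure : t ∈ closure (Set.Iio u) := by
      rw [closure_Iio' ⟨0, pos_iff_ne_zero.2 hu⟩]
      exact ht.2
    obtain ⟨k, hk, hku⟩ := (denseRange_denseSeq ℝ≥0).exists_mem_open (hopen.inter isOpen_Iio)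
      (mem_closure_iff.1 hclosure _ hopen hmem)
    exact ⟨k, le_of_lt hku, hk⟩

lemma approachesZeroOn_neg (w : ℝ≥0 → ℝ) (q u : ℝ≥0) :
    ApproachesZeroOn (-w) q u ↔ ApproachesZeroOn w q u := by
  simp only [ApproachesZeroOn, Pi.neg_apply, abs_neg]

lemma approachesZeroOn_mono {w : ℝ≥0 → ℝ} {q u v : ℝ≥0} (h : ApproachesZeroOn w q u)
    (huv : u ≤ v) : ApproachesZeroOn w q v := fun m ↦
  (h m).imp fun _ hk ↦ ⟨hk.1.trans huv, hk.2⟩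

lemma measurableSet_approachesZeroOn {α : Type*} [MeasurableSpace α] {w : ℝ≥0 → α → ℝ}
    {q u : α → ℝ≥0} (hw : ∀ t, Measurable (w t)) (hq : Measurable q) (hu : Measurable u) :
    MeasurableSet {x | ApproachesZeroOn (w · x) (q x) (u x)} := by
  simp only [ApproachesZeroOn, Set.ofPred_forall, Set.ofPred_exists, Set.ofPred_and]
  exact .iInter fun m ↦ .iUnion fun k ↦ (measurableSet_le measurable_const hu).inter
    ((measurableSet_lt hq measurable_const).inter
      (measurableSet_lt (hw _).abs measurable_const))

lemma approachesZeroOn_stopped (w : ℝ≥0 → ℝ) (q u : ℝ≥0) :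
    ApproachesZeroOn (fun t ↦ w (min t u)) q u ↔ ApproachesZeroOn w q u := by
  refine forall_congr' fun m ↦ exists_congr fun k ↦ and_congr_right fun hk ↦ ?_
  simp only [min_eq_left hk]

lemma measurableSet_natural_approachesZeroOn {Ω : Type*} [MeasurableSpace Ω] {B : ℝ≥0 → Ω → ℝ}
    (hB : ∀ t, StronglyMeasurable (B t)) (q u : ℝ≥0) :
    MeasurableSet[Filtration.natural B hB u] {ω | ApproachesZeroOn (B · ω) q u} := by
  have hstopped (t : ℝ≥0) : Measurable[Filtration.natural B hB u] (B (min t u)) :=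
    ((Filtration.stronglyAdapted_natural hB (min t u)).mono
      ((Filtration.natural B hB).mono (min_le_right t u))).measurable
  have heq : {ω | ApproachesZeroOn (B · ω) q u} =
      {ω | ApproachesZeroOn (fun t ↦ B (min t u) ω) q u} :=
    Set.ext fun ω ↦ (approachesZeroOn_stopped (B · ω) q u).symm
  rw [heq]
  exact @measurableSet_approachesZeroOn Ω (Filtration.natural B hB u) _ _ _ hstopped
    measurable_const measurable_const

end ZeroSet

section FirstHit

variable {s u : ℝ≥0}

/-- The grid of mesh `1 / (n + 1)` started at `s` and stopped at `u`, used to discretize the first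
zero on `[s, u]`. -/
noncomputable def stoppedGrid (s u : ℝ≥0) (n i : ℕ) : ℝ≥0 := min u (s + i / (n + 1))

lemma stoppedGrid_le (s u : ℝ≥0) (n i : ℕ) : stoppedGrid s u n i ≤ u := min_le_left _ _

lemma le_stoppedGrid (hsu : s ≤ u) (n i : ℕ) : s ≤ stoppedGrid s u n i :=
  le_min hsu le_self_add

lemma monotone_stoppedGrid (s u : ℝ≥0) (n : ℕ) : Monotone (stoppedGrid s u n) := by
  intro i j hij
  unfold stoppedGrid
  gcongr

lemma stoppedGrid_zero_le (s u : ℝ≥0) (n : ℕ) : stoppedGrid s u n 0 ≤ s :=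
  (min_le_right _ _).trans (by simp)

lemma stoppedGrid_succ_le (s u : ℝ≥0) (n i : ℕ) :
    stoppedGrid s u n (i + 1) ≤ stoppedGrid s u n i + 1 / (n + 1) := by
  rw [stoppedGrid, stoppedGrid, min_add]
  refine min_le_min le_self_add ?_
  push_cast
  rw [add_div, add_assoc]

lemma exists_stoppedGrid_eq (s u : ℝ≥0) (n : ℕ) : ∃ i, stoppedGrid s u n i = u := by
  obtain ⟨i, hi⟩ := exists_nat_ge (u * (n + 1))
  exact ⟨i, min_eq_left (((le_div_iff₀ (by positivity)).2 hi).trans le_add_self)⟩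

lemma tendsto_eval_stoppedGrid {w : ℝ≥0 → ℝ} (hw : Continuous w) {i : ℕ → ℕ}
    (hzero : ∀ n, ∃ t ∈ Set.Icc s (stoppedGrid s u n (i n)), w t = 0)
    (hfirst : ∀ n, ∀ j < i n, ¬∃ t ∈ Set.Icc s (stoppedGrid s u n j), w t = 0) :
    Tendsto (fun n ↦ w (stoppedGrid s u n (i n))) atTop (𝓝 0) := by
  obtain ⟨z, hz, hwz⟩ := hzero 0
  obtain ⟨τ, ⟨hτ, hwτ⟩, hleast⟩ :=
    (isCompact_Icc.inter_right (isClosed_singleton.preimage hw)).exists_isLeast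
      (s := Set.Icc s u ∩ w ⁻¹' {0}) ⟨z, ⟨hz.1, hz.2.trans (stoppedGrid_le _ _ _ _)⟩, hwz⟩
  have hlower (n : ℕ) : τ ≤ stoppedGrid s u n (i n) := by
    obtain ⟨t, ht, hwt⟩ := hzero n
    exact (hleast ⟨⟨ht.1, ht.2.trans (stoppedGrid_le _ _ _ _)⟩, hwt⟩).trans ht.2
  have hupper (n : ℕ) : stoppedGrid s u n (i n) ≤ τ + 1 / (n + 1) := by
    rcases hi : i n with _ | j
    · exact (stoppedGrid_zero_le s u n).trans (hτ.1.trans le_self_add)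
    · have hlt : stoppedGrid s u n j < τ :=
        lt_of_not_ge fun h ↦ hfirst n j (by omega) ⟨τ, ⟨hτ.1, h⟩, hwτ⟩
      exact (stoppedGrid_succ_le s u n j).trans (by gcongr)
  have hmesh : Tendsto (fun n : ℕ ↦ τ + 1 / ((n : ℝ≥0) + 1)) atTop (𝓝 τ) := by
    simpa using tendsto_one_div_add_atTop_nhds_zero_nat (𝕜 := ℝ≥0) |>.const_add τ
  rw [← show w τ = 0 from hwτ]
  exact (hw.tendsto τ).comp (tendsto_of_tendsto_of_tendsto_of_le_of_le tendsto_const_nhds hmesh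
    hlower hupper)

/-- The event that `B` reaches `0` on `[s, u]` for the first time between the grid points `i - 1`
and `i`. -/
def firstHit {Ω : Type*} (B : ℝ≥0 → Ω → ℝ) (s u : ℝ≥0) (n : ℕ) : ℕ → Set Ω :=
  disjointed fun i ↦ {ω | ApproachesZeroOn (B · ω) s (stoppedGrid s u n i)}

lemma firstHit_neg {Ω : Type*} (B : ℝ≥0 → Ω → ℝ) (s u : ℝ≥0) (n : ℕ) :
    firstHit (-B) s u n = firstHit B s u n :=
  congrArg disjointed (funext fun _ ↦ Set.ext fun ω ↦ approachesZeroOn_neg (B · ω) _ _)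

lemma iUnion_firstHit {Ω : Type*} (B : ℝ≥0 → Ω → ℝ) (s u : ℝ≥0) (n : ℕ) :
    ⋃ i, firstHit B s u n i = {ω | ApproachesZeroOn (B · ω) s u} := by
  refine iUnion_disjointed.trans (Set.Subset.antisymm
    (Set.iUnion_subset fun i ↦ Set.ofPred_subset_ofPred.2 fun ω h ↦
      approachesZeroOn_mono h (stoppedGrid_le s u n i)) fun ω h ↦ ?_)
  obtain ⟨i, hi⟩ := exists_stoppedGrid_eq s u n
  exact Set.mem_iUnion.2 ⟨i, hi.symm ▸ h⟩

lemma tendsto_eval_of_mem_firstHit {Ω : Type*} {B : ℝ≥0 → Ω → ℝ} {ω : Ω}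
    (hω : Continuous (B · ω)) (hs : s ≠ 0) (hsu : s ≤ u) {i : ℕ → ℕ}
    (hi : ∀ n, ω ∈ firstHit B s u n (i n)) :
    Tendsto (fun n ↦ B (stoppedGrid s u n (i n)) ω) atTop (𝓝 0) := by
  have hiff (n j : ℕ) : ApproachesZeroOn (B · ω) s (stoppedGrid s u n j) ↔
      ∃ t ∈ Set.Icc s (stoppedGrid s u n j), B t ω = 0 :=
    approachesZeroOn_iff_exists hω ((pos_iff_ne_zero.2 hs).trans_le (le_stoppedGrid hsu n j)).ne'
  refine tendsto_eval_stoppedGrid hω (fun n ↦ (hiff n _).1 (disjointed_subset _ _ (hi n)))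
    fun n j hj hzero ↦ ?_
  have h := hi n
  rw [firstHit, disjointed_eq_inter_compl] at h
  exact Set.mem_iInter₂.1 h.2 j hj ((hiff n j).2 hzero)

end FirstHit

section Reflection

variable {Ω : Type*} [MeasurableSpace Ω] {P : Measure Ω} {B : ℝ≥0 → Ω → ℝ} {s t u : ℝ≥0}
  {A G : Set Ω}

lemma gaussianReal_Iio_zero (v : ℝ≥0) :
    gaussianReal 0 v (Set.Iio 0) = gaussianReal 0 v (Set.Ioi 0) := by
  have h := gaussianReal_map_neg (μ := 0) (v := v)
  rw [neg_zero] at h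
  conv_lhs => rw [← h]
  rw [Measure.map_apply measurable_neg measurableSet_Iio, Set.neg_preimage, Set.neg_Iio, neg_zero]

lemma ae_eval_ne_zero (hB : IsPreBrownianReal B P) (ht : t ≠ 0) : ∀ᵐ ω ∂P, B t ω ≠ 0 := by
  have := nullSingletonClass_gaussianReal (μ := 0) ht
  exact (hB.hasLaw_eval t).ae_iff (p := (· ≠ 0)) (by measurability) |>.2
    (measure_eq_zero_iff_ae_notMem.1 (measure_singleton (0 : ℝ)))

lemma measure_eq_add_of_ae_ne_zero {X : Ω → ℝ} (hX : Measurable X) (hne : ∀ᵐ ω ∂P, X ω ≠ 0) :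
    P A = P (A ∩ {ω | X ω < 0}) + P (A ∩ {ω | 0 < X ω}) := by
  have hpos : (A ∩ {ω | 0 < X ω} : Set Ω) =ᵐ[P] (A \ {ω | X ω < 0} : Set Ω) := by
    filter_upwards [hne] with ω hω
    exact propext (and_congr_right fun _ ↦ (not_lt.trans hω.symm.le_iff_lt).symm)
  rw [measure_congr hpos, measure_inter_add_sdiff A (measurableSet_lt hX measurable_const)]

lemma measure_inter_sub_mem (hB : IsPreBrownianReal B P) (hm : ∀ t, StronglyMeasurable (B t))
    (htu : t ≤ u) (hA : MeasurableSet[Filtration.natural B hm t] A) {S : Set ℝ}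
    (hS : MeasurableSet S) :
    P (A ∩ {ω | B u ω - B t ω ∈ S}) = P A * gaussianReal 0 (u - t) S := by
  have hincr : {ω | B u ω - B t ω ∈ S} = (fun ω ↦ B (t + (u - t)) ω - B t ω) ⁻¹' S := by
    rw [add_tsub_cancel_of_le htu]
    rfl
  have hmeas : Measurable fun ω ↦ B (t + (u - t)) ω - B t ω :=
    (hm _).measurable.sub (hm t).measurable
  have hindep := (hB.indepFun_shift t).symm.comp measurable_id (measurable_pi_apply (u - t))
  rw [Filtration.natural_eq_comap] at hA
  rw [hincr, ← ((hB.shift t).hasLaw_eval (u - t)).map_eq, Measure.map_apply hmeas hS]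
  exact (Indep_iff _ _ _).1 hindep _ _ hA ⟨S, hS, rfl⟩

lemma measure_inter_lt_eq_gt (hB : IsPreBrownianReal B P) (hm : ∀ t, StronglyMeasurable (B t))
    (htu : t ≤ u) (hA : MeasurableSet[Filtration.natural B hm t] A) :
    P (A ∩ {ω | B u ω < B t ω}) = P (A ∩ {ω | B t ω < B u ω}) := by
  have hlt := measure_inter_sub_mem hB hm htu hA (measurableSet_Iio (a := 0))
  have hgt := measure_inter_sub_mem hB hm htu hA (measurableSet_Ioi (a := 0))
  simp only [Set.mem_Iio, Set.mem_Ioi, sub_neg, sub_pos] at hlt hgt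
  rw [hlt, hgt, gaussianReal_Iio_zero]

-- The strong Markov property and symmetry at the discrete stopping time equal to `t i` on `E i`.
lemma measure_iUnion_inter_lt_eq_gt (hB : IsPreBrownianReal B P)
    (hm : ∀ t, StronglyMeasurable (B t)) {t : ℕ → ℝ≥0} (htu : ∀ i, t i ≤ u) {E : ℕ → Set Ω}
    (hdisj : Pairwise (Function.onFun Disjoint E))
    (hE : ∀ i, MeasurableSet[Filtration.natural B hm (t i)] (E i)) :
    P (⋃ i, E i ∩ {ω | B u ω < B (t i) ω}) = P (⋃ i, E i ∩ {ω | B (t i) ω < B u ω}) := by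
  have hE' (i : ℕ) : MeasurableSet (E i) := (Filtration.natural B hm).le _ _ (hE i)
  have hB' (t : ℝ≥0) : Measurable (B t) := (hm t).measurable
  rw [measure_iUnion (hdisj.mono fun _ _ h ↦ h.mono Set.inter_subset_left Set.inter_subset_left)
      fun i ↦ (hE' i).inter (measurableSet_lt (hB' _) (hB' _)),
    measure_iUnion (hdisj.mono fun _ _ h ↦ h.mono Set.inter_subset_left Set.inter_subset_left)
      fun i ↦ (hE' i).inter (measurableSet_lt (hB' _) (hB' _))]
  exact tsum_congr fun i ↦ measure_inter_lt_eq_gt hB hm (htu i) (hE i)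

lemma measurableSet_natural_firstHit (hm : ∀ t, StronglyMeasurable (B t)) (s u : ℝ≥0)
    (n i : ℕ) :
    MeasurableSet[Filtration.natural B hm (stoppedGrid s u n i)] (firstHit B s u n i) := by
  rw [firstHit, disjointed_eq_inter_compl]
  refine (measurableSet_natural_approachesZeroOn hm s _).inter
    (.iInter fun j ↦ .iInter fun hj ↦ .compl ?_)
  exact (Filtration.natural B hm).mono (monotone_stoppedGrid s u n hj.le) _
    (measurableSet_natural_approachesZeroOn hm s _)

lemma tendsto_measure_firstHit (hB : IsBrownianReal B P) (hm : ∀ t, Measurable (B t)) (hs : s ≠ 0)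
    (hsu : s ≤ u) (hG : MeasurableSet G) :
    Tendsto (fun n ↦ P (⋃ i, G ∩ firstHit B s u n i ∩ {ω | B u ω < B (stoppedGrid s u n i) ω}))
      atTop (𝓝 (P (G ∩ {ω | ApproachesZeroOn (B · ω) s u} ∩ {ω | B u ω < 0}))) := by
  have := hB.isGaussianProcess.isProbabilityMeasure
  have hfirst (n i : ℕ) : MeasurableSet (firstHit B s u n i) :=
    (Filtration.natural B fun t ↦ (hm t).stronglyMeasurable).le _ _
      (measurableSet_natural_firstHit _ s u n i)
  have hhit : MeasurableSet {ω | ApproachesZeroOn (B · ω) s u} :=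
    measurableSet_approachesZeroOn hm measurable_const measurable_const
  refine tendsto_measure_of_ae_tendsto_indicator_of_isFiniteMeasure atTop
    ((hG.inter hhit).inter (measurableSet_lt (hm u) measurable_const))
    (fun n ↦ .iUnion fun i ↦ (hG.inter (hfirst n i)).inter (measurableSet_lt (hm u) (hm _))) ?_
  have hu : u ≠ 0 := ((pos_iff_ne_zero.2 hs).trans_le hsu).ne'
  filter_upwards [hB.cont, ae_eval_ne_zero hB.toIsPreBrownianReal hu] with ω hω hne
  by_cases hω' : ω ∈ {ω | ApproachesZeroOn (B · ω) s u}
  · have hex (n : ℕ) : ∃ i, ω ∈ firstHit B s u n i :=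
      Set.mem_iUnion.1 ((iUnion_firstHit B s u n).symm ▸ hω')
    choose i hi using hex
    have hiff (n j : ℕ) : ω ∈ firstHit B s u n j ↔ j = i n :=
      ⟨fun hj ↦ by_contra fun hji ↦ (Set.disjoint_left.1 (disjoint_disjointed _ hji)) hj (hi n),
        fun hj ↦ hj ▸ hi n⟩
    have hsign : ∀ᶠ n in atTop, (B u ω < B (stoppedGrid s u n (i n)) ω ↔ B u ω < 0) := by
      have hlim := tendsto_eval_of_mem_firstHit hω hs hsu hi
      rcases lt_or_gt_of_ne hne with hlt | hgt
      · exact (hlim.eventually_const_lt hlt).mono fun n h ↦ iff_of_true h hlt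
      · exact (hlim.eventually_lt_const hgt).mono fun n h ↦ iff_of_false h.not_gt hgt.not_gt
    filter_upwards [hsign] with n hn
    simp [hiff, hn, show ApproachesZeroOn (B · ω) s u from hω']
  · refine Eventually.of_forall fun n ↦ iff_of_false (fun h ↦ ?_) fun h ↦ hω' h.1.2
    obtain ⟨i, hi⟩ := Set.mem_iUnion.1 h
    exact hω' (iUnion_firstHit B s u n ▸ Set.mem_iUnion.2 ⟨i, hi.1.2⟩)

lemma measure_inter_approachesZeroOn_neg_eq_pos (hB : IsBrownianReal B P)
    (hm : ∀ t, Measurable (B t)) (hs : s ≠ 0) (hsu : s ≤ u)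
    (hG : MeasurableSet[Filtration.natural B (fun t ↦ (hm t).stronglyMeasurable) s] G) :
    P (G ∩ {ω | ApproachesZeroOn (B · ω) s u} ∩ {ω | B u ω < 0}) =
      P (G ∩ {ω | ApproachesZeroOn (B · ω) s u} ∩ {ω | 0 < B u ω}) := by
  have hG' : MeasurableSet G := (Filtration.natural B _).le s G hG
  have hlt := tendsto_measure_firstHit hB hm hs hsu hG'
  have hgt := tendsto_measure_firstHit hB.neg (fun t ↦ (hm t).neg) hs hsu hG'
  simp only [firstHit_neg, Pi.neg_apply, neg_lt_neg_iff, Left.neg_neg_iff] at hgt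
  have hneg : {ω | ApproachesZeroOn (fun t ↦ -B t ω) s u} = {ω | ApproachesZeroOn (B · ω) s u} :=
    Set.ext fun ω ↦ approachesZeroOn_neg (B · ω) s u
  rw [hneg] at hgt
  refine tendsto_nhds_unique hlt (hgt.congr fun n ↦ (measure_iUnion_inter_lt_eq_gt
    hB.toIsPreBrownianReal (fun t ↦ (hm t).stronglyMeasurable) (stoppedGrid_le s u n)
    ((disjoint_disjointed _).mono fun _ _ h ↦
      h.mono Set.inter_subset_right Set.inter_subset_right) fun i ↦ ?_).symm)
  exact ((Filtration.natural B _).mono (le_stoppedGrid hsu n i) _ hG).inter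
    (measurableSet_natural_firstHit _ s u n i)

lemma measure_pos_inter_approachesZeroOn (hB : IsBrownianReal B P) (hm : ∀ t, Measurable (B t))
    (hs : s ≠ 0) (hsu : s ≤ u) :
    P ({ω | 0 < B s ω} ∩ {ω | ApproachesZeroOn (B · ω) s u}) =
      2 * P {ω | 0 < B s ω ∧ B u ω < 0} := by
  have hu : u ≠ 0 := ((pos_iff_ne_zero.2 hs).trans_le hsu).ne'
  have hG : MeasurableSet[Filtration.natural B (fun t ↦ (hm t).stronglyMeasurable) s]
      {ω | 0 < B s ω} :=
    measurableSet_lt measurable_const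
      (Filtration.stronglyAdapted_natural (fun t ↦ (hm t).stronglyMeasurable) s).measurable
  have hcross : ({ω | 0 < B s ω} ∩ {ω | ApproachesZeroOn (B · ω) s u} ∩ {ω | B u ω < 0} : Set Ω)
      =ᵐ[P] {ω | 0 < B s ω ∧ B u ω < 0} := by
    filter_upwards [hB.cont] with ω hω
    refine propext ⟨fun h ↦ ⟨h.1.1, h.2⟩, fun h ↦ ⟨⟨h.1, ?_⟩, h.2⟩⟩
    exact (approachesZeroOn_iff_exists hω hu).2
      (intermediate_value_Icc' hsu hω.continuousOn ⟨h.2.le, h.1.le⟩)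
  rw [measure_eq_add_of_ae_ne_zero (hm u) (ae_eval_ne_zero hB.toIsPreBrownianReal hu),
    ← measure_inter_approachesZeroOn_neg_eq_pos hB hm hs hsu hG, measure_congr hcross, two_mul]

lemma measure_pos_neg (hB : IsPreBrownianReal B P) (hs : s ≠ 0) (hsu : s < u) :
    P {ω | 0 < B s ω ∧ B u ω < 0} =
      ENNReal.ofReal ((Real.pi / 2 - Real.arctan √(s / (u - s))) / (2 * Real.pi)) := by
  have := hB.isGaussianProcess.isProbabilityMeasure
  have hindep : B s ⟂ᵢ[P] (B s - B u) := by
    have h := (hB.hasIndepIncrements.indepFun_eval_sub zero_le hsu.le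
      hB.eval_zero_ae_eq_zero).comp measurable_id measurable_neg
    convert! h using 1
    ext ω
    simp
  have hlaw : P.map (B s - B u) = gaussianReal 0 (u - s) := by
    rw [(hB.hasLaw_sub s u).map_eq]
    congr 1
    ext
    rw [coe_nndist, NNReal.coe_sub hsu.le, dist_comm]
    exact abs_of_nonneg (sub_nonneg.2 (NNReal.coe_le_coe.2 hsu.le))
  have hprod := (indepFun_iff_map_prod_eq_prod_map_map (hB.aemeasurable s)
    ((hB.aemeasurable s).sub (hB.aemeasurable u))).1 hindep
  rw [(hB.hasLaw_eval s).map_eq, hlaw] at hprod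
  have hmeas : MeasurableSet {p : ℝ × ℝ | 0 < p.1 ∧ p.1 < p.2} :=
    (measurableSet_lt measurable_const measurable_fst).inter
      (measurableSet_lt measurable_fst measurable_snd)
  rw [← NNReal.coe_sub hsu.le, ← gaussianReal_prod_pos_lt (tsub_pos_of_lt hsu).ne' hs, ← hprod,
    Measure.map_apply_of_aemeasurable
      ((hB.aemeasurable s).prodMk ((hB.aemeasurable s).sub (hB.aemeasurable u))) hmeas]
  refine congrArg P (Set.ext fun ω ↦ and_congr_right fun _ ↦ ?_)
  change B u ω < 0 ↔ B s ω < B s ω - B u ω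
  rw [lt_sub_comm, sub_self]

lemma arctan_sqrt_div_sub {x y : ℝ} (hx : 0 ≤ x) (hxy : x < y) :
    Real.arctan √(x / (y - x)) = Real.arcsin √(x / y) := by
  have hsub : 0 < y - x := sub_pos.2 hxy
  rw [Real.arctan_eq_arcsin, Real.sq_sqrt (by positivity), ← Real.sqrt_div (by positivity)]
  congr 2
  have hy : y ≠ 0 := (hx.trans_lt hxy).ne'
  field_simp
  ring

lemma measure_approachesZeroOn_eq_four_mul (hB : IsBrownianReal B P) (hm : ∀ t, Measurable (B t))
    (hs : s ≠ 0) (hsu : s < u) :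
    P {ω | ApproachesZeroOn (B · ω) s u} = 4 * P {ω | 0 < B s ω ∧ B u ω < 0} := by
  have hpos := measure_pos_inter_approachesZeroOn hB hm hs hsu.le
  have hneg := measure_pos_inter_approachesZeroOn hB.neg (fun t ↦ (hm t).neg) hs hsu.le
  rw [measure_pos_neg hB.neg.toIsPreBrownianReal hs hsu,
    ← measure_pos_neg hB.toIsPreBrownianReal hs hsu] at hneg
  have hzero : {ω | ApproachesZeroOn (fun t ↦ (-B) t ω) s u} =
      {ω | ApproachesZeroOn (B · ω) s u} :=
    Set.ext fun ω ↦ approachesZeroOn_neg (B · ω) s u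
  rw [hzero] at hneg
  simp only [Pi.neg_apply, Left.neg_pos_iff] at hneg
  rw [measure_eq_add_of_ae_ne_zero (hm s) (ae_eval_ne_zero hB.toIsPreBrownianReal hs),
    Set.inter_comm, hneg, Set.inter_comm, hpos, ← add_mul]
  norm_num

theorem measure_approachesZeroOn (hB : IsBrownianReal B P) (hm : ∀ t, Measurable (B t))
    (hsu : s ≤ u) (hu : u ≠ 0) :
    P {ω | ApproachesZeroOn (B · ω) s u} =
      ENNReal.ofReal (1 - 2 / Real.pi * Real.arcsin √(s / u)) := by
  have := hB.isGaussianProcess.isProbabilityMeasure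
  rcases eq_or_ne s 0 with rfl | hs
  · have hstart : ∀ᵐ ω ∂P, ApproachesZeroOn (B · ω) 0 u := by
      filter_upwards [hB.cont, hB.eval_zero_ae_eq_zero] with ω hω h0
      exact (approachesZeroOn_iff_exists hω hu).2 ⟨0, ⟨le_rfl, zero_le⟩, h0⟩
    simpa using prob_compl_eq_zero_iff₀ (μ := P)
      (measurableSet_approachesZeroOn hm measurable_const measurable_const).nullMeasurableSet
      |>.1 hstart
  rcases hsu.eq_or_lt with rfl | hsu
  · have hne : ∀ᵐ ω ∂P, ¬ApproachesZeroOn (B · ω) s s := by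
      filter_upwards [hB.cont, ae_eval_ne_zero hB.toIsPreBrownianReal hs] with ω hω hne
      rw [approachesZeroOn_iff_exists hω hs]
      rintro ⟨t, ht, h⟩
      exact hne (le_antisymm ht.2 ht.1 ▸ h)
    have hnull : P {ω | ApproachesZeroOn (B · ω) s s} = 0 := measure_eq_zero_iff_ae_notMem.2 hne
    rw [hnull, div_self (NNReal.coe_ne_zero.2 hs), Real.sqrt_one,
      Real.arcsin_one, div_mul_div_cancel₀ Real.pi_ne_zero, div_self two_ne_zero, sub_self,
      ENNReal.ofReal_zero]
  · rw [measure_approachesZeroOn_eq_four_mul hB hm hs hsu,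
      measure_pos_neg hB.toIsPreBrownianReal hs hsu,
      arctan_sqrt_div_sub s.coe_nonneg (NNReal.coe_lt_coe.2 hsu),
      ← ENNReal.ofReal_ofNat, ← ENNReal.ofReal_mul (by positivity)]
    congr 1
    field_simp
    ring

end Reflection

section LastJump

open TopologicalSpace (denseSeq denseRange_denseSeq)

/-- The law of the maximum of `j` independent uniform variables on `[0, 1]`, with the value `0` for
`j = 0`. It is the conditional law of the last jump time of a Poisson process before time `1`,
given that there are `j` jumps. -/
noncomputable def maxUniformMeasure : ℕ → Measure ℝ
  | 0 => .dirac 0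
  | j + 1 => betaMeasure (j + 1) 1

lemma ae_mem_Ico_maxUniformMeasure : ∀ j, ∀ᵐ x ∂maxUniformMeasure j, x ∈ Set.Ico (0 : ℝ) 1
  | 0 => (ae_dirac_iff measurableSet_Ico).2 ⟨le_rfl, one_pos⟩
  | j + 1 => (ae_mem_Ioo_betaMeasure (j + 1) 1).mono fun _ hx ↦ Set.Ioo_subset_Ico_self hx

lemma maxUniformMeasure_Iic {t : ℝ} (ht0 : 0 ≤ t) (ht1 : t ≤ 1) :
    ∀ j, maxUniformMeasure j (Set.Iic t) = ENNReal.ofReal (t ^ j)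
  | 0 => by simp [maxUniformMeasure, ht0]
  | j + 1 => by
    rw [maxUniformMeasure, betaMeasure_one_Iic (by positivity) ht0 ht1]
    norm_cast

lemma bind_maxUniformMeasure_arcsineMeasure :
    ∀ j, (maxUniformMeasure j).bind (arcsineMeasure · 1) = betaMeasure (j + 1 / 2) (1 / 2)
  | 0 => by
    rw [maxUniformMeasure, Measure.dirac_bind (measurable_arcsineMeasure 1),
      arcsineMeasure_zero_one, Nat.cast_zero, zero_add]
  | j + 1 => by
    rw [maxUniformMeasure, bind_betaMeasure_arcsineMeasure (by positivity), Nat.cast_succ]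

lemma lintegral_pow_poissonMeasure (r : ℝ≥0) {t : ℝ} (ht : 0 ≤ t) :
    ∫⁻ j, ENNReal.ofReal (t ^ j) ∂poissonMeasure r =
      ENNReal.ofReal (Real.exp (-(r * (1 - t)))) := by
  have hsum : HasSum (fun j : ℕ ↦ Real.exp (-r) * r ^ j / j.factorial * t ^ j)
      (Real.exp (-(r * (1 - t)))) := by
    convert! (NormedSpace.expSeries_div_hasSum_exp (r * t : ℝ)).mul_left (Real.exp (-r)) using 1
    · exact funext fun j ↦ by ring
    · rw [← Real.exp_eq_exp_ℝ, ← Real.exp_add]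
      ring_nf
  rw [poissonMeasure, lintegral_sum_measure, ← hsum.tsum_eq,
    ENNReal.ofReal_tsum_of_nonneg (fun j ↦ by positivity) hsum.summable]
  simp_rw [lintegral_smul_measure, lintegral_dirac, smul_eq_mul]
  exact tsum_congr fun j ↦ (ENNReal.ofReal_mul (by positivity)).symm

lemma ae_bind_of_discrete {ι α : Type*} [MeasurableSpace ι] [DiscreteMeasurableSpace ι]
    [MeasurableSpace α] {μ : Measure ι} {ν : ι → Measure α} {p : α → Prop}
    (hp : MeasurableSet {x | p x}) (h : ∀ i, ∀ᵐ x ∂ν i, p x) : ∀ᵐ x ∂μ.bind ν, p x := by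
  rw [ae_iff, ← Set.compl_ofPred, Measure.bind_apply hp.compl .of_discrete]
  exact lintegral_eq_zero_of_ae_eq_zero (ae_of_all _ h)

lemma ext_of_Iic_of_ae_mem_Icc {α : Type*} [TopologicalSpace α] [MeasurableSpace α]
    [SecondCountableTopology α] [LinearOrder α] [OrderTopology α] [BorelSpace α] {a b : α}
    {μ ν : Measure α} [IsFiniteMeasure μ] (hμ : ∀ᵐ x ∂μ, x ∈ Set.Icc a b)
    (hν : ∀ᵐ x ∂ν, x ∈ Set.Icc a b) (h : ∀ t ∈ Set.Icc a b, μ (Set.Iic t) = ν (Set.Iic t)) :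
    μ = ν := by
  rcases lt_or_ge b a with hba | hab
  · rw [Set.Icc_eq_empty hba.not_ge] at hμ hν
    rw [ae_eq_bot.1 (eventually_false_iff_eq_bot.1 hμ),
      ae_eq_bot.1 (eventually_false_iff_eq_bot.1 hν)]
  refine Measure.ext_of_Iic μ ν fun t ↦ ?_
  rcases lt_or_ge t a with hta | hta
  · have hnull (ρ : Measure α) (hρ : ∀ᵐ x ∂ρ, x ∈ Set.Icc a b) : ρ (Set.Iic t) = 0 :=
      measure_eq_zero_iff_ae_notMem.2 (hρ.mono fun x hx hxt ↦ (hta.trans_le hx.1).not_ge hxt)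
    rw [hnull μ hμ, hnull ν hν]
  · have hmin (ρ : Measure α) (hρ : ∀ᵐ x ∂ρ, x ∈ Set.Icc a b) :
        ρ (Set.Iic t) = ρ (Set.Iic (min t b)) :=
      measure_congr (hρ.mono fun x hx ↦
        propext ⟨fun h ↦ le_min h hx.2, fun h ↦ (le_min_iff.1 h).1⟩)
    rw [hmin μ hμ, hmin ν hν]
    exact h _ ⟨le_min hta hab, min_le_right _ _⟩

lemma ext_of_Ici_of_ae_mem_Icc {α : Type*} [TopologicalSpace α] [mα : MeasurableSpace α]
    [SecondCountableTopology α] [LinearOrder α] [OrderTopology α] [BorelSpace α] {a b : α}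
    {μ ν : Measure α} [IsFiniteMeasure μ] (hμ : ∀ᵐ x ∂μ, x ∈ Set.Icc a b)
    (hν : ∀ᵐ x ∂ν, x ∈ Set.Icc a b) (h : ∀ t ∈ Set.Icc a b, μ (Set.Ici t) = ν (Set.Ici t)) :
    μ = ν :=
  @ext_of_Iic_of_ae_mem_Icc αᵒᵈ _ mα _ _ _ _ b a μ ν ‹_› (hμ.mono fun _ hx ↦ ⟨hx.2, hx.1⟩)
    (hν.mono fun _ hx ↦ ⟨hx.2, hx.1⟩) fun t ht ↦ h t ⟨ht.2, ht.1⟩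

/-- The time of the last jump before time `1` of a counting path `n`, or `0` if there is none: the
infimum of the times `t` with `n 1 ≤ n t`, taken along a countable dense set to make it a measurable
function of the path. -/
noncomputable def lastJump (n : ℝ≥0 → ℕ) : ℝ≥0 :=
  ⨅ k : ℕ, if n 1 ≤ n (denseSeq ℝ≥0 k) then denseSeq ℝ≥0 k else 1

lemma measurable_lastJump : Measurable lastJump :=
  .iInf fun _ ↦ .ite (measurableSet_le (measurable_pi_apply _) (measurable_pi_apply _))
    measurable_const measurable_const

lemma lastJump_eq_sInf {n : ℝ≥0 → ℕ} (hn : Monotone n) :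
    lastJump n = sInf {t : ℝ≥0 | n 1 ≤ n t} := by
  have hone : 1 ∈ {t : ℝ≥0 | n 1 ≤ n t} := le_refl (n 1)
  refine le_antisymm (le_of_forall_gt fun y hy ↦ ?_) (le_ciInf fun k ↦ ?_)
  · obtain ⟨t, ht, hty⟩ := exists_lt_of_csInf_lt ⟨1, hone⟩ hy
    obtain ⟨_, ⟨k, rfl⟩, htk, hky⟩ := (denseRange_denseSeq ℝ≥0).exists_between hty
    refine (ciInf_le (OrderBot.bddBelow _) k).trans_lt ?_
    rwa [if_pos (le_trans ht (hn htk.le))]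
  · split_ifs with h
    · exact csInf_le (OrderBot.bddBelow _) h
    · exact csInf_le (OrderBot.bddBelow _) hone

lemma le_eval_lastJump {n : ℝ≥0 → ℕ} (hn : Monotone n)
    (hc : ∀ t : ℝ≥0, ContinuousWithinAt n (Set.Ici t) t) : n 1 ≤ n (lastJump n) := by
  have hconst : ∀ᶠ t in 𝓝[≥] lastJump n, n t = n (lastJump n) :=
    (hc _).eventually ((isOpen_discrete {n (lastJump n)}).mem_nhds rfl)
  obtain ⟨b, hb, hsub⟩ := (mem_nhdsGE_iff_exists_Ico_subset' (lt_add_one _)).1 hconst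
  rw [lastJump_eq_sInf hn] at hb
  obtain ⟨t, ht, htb⟩ := exists_lt_of_csInf_lt (s := {t : ℝ≥0 | n 1 ≤ n t}) ⟨1, le_refl (n 1)⟩ hb
  rw [← hsub ⟨lastJump_eq_sInf hn ▸ csInf_le (OrderBot.bddBelow _) ht, htb⟩]
  exact ht

lemma lastJump_le_iff {n : ℝ≥0 → ℕ} (hn : Monotone n)
    (hc : ∀ t : ℝ≥0, ContinuousWithinAt n (Set.Ici t) t) {t : ℝ≥0} :
    lastJump n ≤ t ↔ n 1 ≤ n t :=
  ⟨fun h ↦ (le_eval_lastJump hn hc).trans (hn h),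
    fun h ↦ lastJump_eq_sInf hn ▸ csInf_le (OrderBot.bddBelow _) h⟩

variable {Ω : Type*} [MeasurableSpace Ω] {P : Measure Ω} {N : ℝ≥0 → Ω → ℕ} {r : ℝ≥0}

lemma IsPoissonProcess.isProbabilityMeasure (hN : IsPoissonProcess N r P) :
    IsProbabilityMeasure P := (hN.hasLaw_increment 0 0).isProbabilityMeasure

lemma IsPoissonProcess.measurable_lastJump (hN : IsPoissonProcess N r P) :
    Measurable fun ω ↦ (lastJump (N · ω) : ℝ) :=
  (BrownianResetting.measurable_lastJump.comp
    (measurable_pi_lambda _ hN.measurable)).coe_nnreal_real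

lemma IsPoissonProcess.measure_lastJump_le (hN : IsPoissonProcess N r P) {t : ℝ≥0} (ht : t ≤ 1) :
    P {ω | lastJump (N · ω) ≤ t} = ENNReal.ofReal (Real.exp (-(r * (1 - t)))) := by
  have hnojump : {ω | lastJump (N · ω) ≤ t} =ᵐ[P]
      {ω | N (t + (1 - t)) ω - N t ω = 0} := by
    filter_upwards [hN.mono, hN.rightCont] with ω hmono hcont
    refine propext ((lastJump_le_iff hmono hcont).trans ?_)
    rw [add_tsub_cancel_of_le ht]
    exact Nat.sub_eq_zero_iff_le.symm
  rw [measure_congr hnojump, (hN.hasLaw_increment t (1 - t)).measure_eq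
    (p := (· = 0)) (measurableSet_singleton 0), Set.ofPred_eq_eq_singleton,
    poissonMeasure_singleton]
  simp [NNReal.coe_sub ht]

theorem IsPoissonProcess.hasLaw_lastJump (hN : IsPoissonProcess N r P) :
    HasLaw (fun ω ↦ (lastJump (N · ω) : ℝ)) ((poissonMeasure r).bind maxUniformMeasure) P where
  aemeasurable := hN.measurable_lastJump.aemeasurable
  map_eq := by
    have := hN.isProbabilityMeasure
    have := Measure.isProbabilityMeasure_map (μ := P) hN.measurable_lastJump.aemeasurable
    refine ext_of_Iic_of_ae_mem_Icc ?_ (ae_bind_of_discrete measurableSet_Icc fun j ↦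
      (ae_mem_Ico_maxUniformMeasure j).mono fun _ hx ↦ Set.Ico_subset_Icc_self hx) ?_
    · refine (ae_map_iff hN.measurable_lastJump.aemeasurable measurableSet_Icc).2 ?_
      filter_upwards [hN.mono, hN.rightCont] with ω hmono hcont
      exact ⟨NNReal.coe_nonneg _,
        NNReal.coe_le_one.2 ((lastJump_le_iff hmono hcont).2 le_rfl)⟩
    · rintro t ⟨ht0, ht1⟩
      rw [Measure.map_apply hN.measurable_lastJump measurableSet_Iic,
        Measure.bind_apply measurableSet_Iic .of_discrete]
      simp_rw [maxUniformMeasure_Iic ht0 ht1]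
      rw [lintegral_pow_poissonMeasure r ht0]
      lift t to ℝ≥0 using ht0
      exact hN.measure_lastJump_le (NNReal.coe_le_one.1 ht1)

end LastJump

section LastZero

lemma measure_of_indepFun_eq_lintegral {Ω α β : Type*} [MeasurableSpace Ω] [MeasurableSpace α]
    [MeasurableSpace β] {P : Measure Ω} [IsFiniteMeasure P] {A : Ω → α} {B : Ω → β}
    {p : α → β → Prop}
    (hAB : A ⟂ᵢ[P] B) (hA : Measurable A) (hB : Measurable B)
    (hp : MeasurableSet {x : α × β | p x.1 x.2}) :
    P {ω | p (A ω) (B ω)} = ∫⁻ ω, P {ω' | p (A ω') (B ω)} ∂P := by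
  calc P {ω | p (A ω) (B ω)} = (P.map fun ω ↦ (A ω, B ω)) {x | p x.1 x.2} :=
        (Measure.map_apply (hA.prodMk hB) hp).symm
    _ = ∫⁻ b, P.map A {a | p a b} ∂P.map B := by
        rw [hAB.map_prod_eq_prod_map_map hA.aemeasurable hB.aemeasurable,
          Measure.prod_apply_symm hp]
        rfl
    _ = ∫⁻ ω, P {ω' | p (A ω') (B ω)} ∂P := by
        rw [lintegral_map _ hB]
        · exact lintegral_congr fun ω ↦ Measure.map_apply hA (measurable_prodMk_right hp)
        · exact measurable_measure_prodMk_right hp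

lemma measurableSet_approachesZeroOn_after_lastJump (x : ℝ≥0) :
    MeasurableSet {p : (ℕ → ℝ≥0 → ℝ) × (ℝ≥0 → ℕ) |
      ApproachesZeroOn (p.1 (p.2 1)) (x - lastJump p.2) (1 - lastJump p.2)} := by
  have hT : Measurable fun p : (ℕ → ℝ≥0 → ℝ) × (ℝ≥0 → ℕ) ↦ lastJump p.2 :=
    measurable_lastJump.comp measurable_snd
  refine measurableSet_approachesZeroOn (w := fun t p ↦ p.1 (p.2 1) t) (fun t ↦ ?_)
    (measurable_const.sub hT) (measurable_const.sub hT)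
  have heval : Measurable fun q : (ℕ → ℝ≥0 → ℝ) × ℕ ↦ q.1 q.2 t :=
    measurable_from_prod_countable_left fun k ↦
      (measurable_pi_apply t).comp (measurable_pi_apply k)
  exact heval.comp (measurable_fst.prodMk ((measurable_pi_apply 1).comp measurable_snd))

variable {Ω : Type*} {W : ℕ → ℝ≥0 → Ω → ℝ} {N : ℝ≥0 → Ω → ℕ} {ω : Ω}

lemma lastZero_mem_Icc (X : ℝ≥0 → Ω → ℝ) (ω : Ω) : lastZero X ω ∈ Set.Icc (0 : ℝ) 1 :=
  ⟨NNReal.coe_nonneg _, NNReal.coe_le_one.2 (csSup_le' fun _ ht ↦ ht.1)⟩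

lemma resetProcess_eq_of_lastJump_le (hn : Monotone (N · ω))
    (hc : ∀ t : ℝ≥0, ContinuousWithinAt (N · ω) (Set.Ici t) t) {t : ℝ≥0}
    (ht : lastJump (N · ω) ≤ t) (ht1 : t ≤ 1) :
    resetProcess W N t ω = W (N 1 ω) (t - lastJump (N · ω)) ω := by
  have hconst : N t ω = N 1 ω := le_antisymm (hn ht1) ((lastJump_le_iff hn hc).1 ht)
  rw [resetProcess, hconst, jumpTime, ← lastJump_eq_sInf hn]

lemma exists_isGreatest_zeros_resetProcess (hn : Monotone (N · ω))
    (hc : ∀ t : ℝ≥0, ContinuousWithinAt (N · ω) (Set.Ici t) t)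
    (hw : Continuous (W (N 1 ω) · ω)) (h0 : W (N 1 ω) 0 ω = 0) :
    ∃ z, lastJump (N · ω) ≤ z ∧ IsGreatest {t | t ≤ 1 ∧ resetProcess W N t ω = 0} z := by
  have hT1 : lastJump (N · ω) ≤ 1 := (lastJump_le_iff hn hc).2 le_rfl
  have hcompact : IsCompact
      {t ∈ Set.Icc (lastJump (N · ω)) 1 | W (N 1 ω) (t - lastJump (N · ω)) ω = 0} :=
    isCompact_Icc.inter_right
      (isClosed_eq (hw.comp (continuous_id.sub continuous_const)) continuous_const)
  obtain ⟨z, ⟨hz, hz0⟩, hmax⟩ := hcompact.exists_isGreatest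
    ⟨lastJump (N · ω), ⟨le_rfl, hT1⟩, by rwa [tsub_self]⟩
  refine ⟨z, hz.1, ⟨hz.2, by rwa [resetProcess_eq_of_lastJump_le hn hc hz.1 hz.2]⟩, ?_⟩
  rintro t ⟨ht1, ht⟩
  rcases le_total t (lastJump (N · ω)) with htT | hTt
  · exact htT.trans hz.1
  · rw [resetProcess_eq_of_lastJump_le hn hc hTt ht1] at ht
    exact hmax ⟨⟨hTt, ht1⟩, ht⟩

lemma le_lastZero_resetProcess_iff (hn : Monotone (N · ω))
    (hc : ∀ t : ℝ≥0, ContinuousWithinAt (N · ω) (Set.Ici t) t)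
    (hw : Continuous (W (N 1 ω) · ω)) (h0 : W (N 1 ω) 0 ω = 0) {x : ℝ≥0} :
    (x : ℝ) ≤ lastZero (resetProcess W N) ω ↔
      ∃ t ∈ Set.Icc (x - lastJump (N · ω)) (1 - lastJump (N · ω)), W (N 1 ω) t ω = 0 := by
  have hT1 : lastJump (N · ω) ≤ 1 := (lastJump_le_iff hn hc).2 le_rfl
  obtain ⟨z, hTz, hz⟩ := exists_isGreatest_zeros_resetProcess hn hc hw h0
  rw [lastZero, hz.csSup_eq, NNReal.coe_le_coe]
  constructor
  · refine fun hxz ↦ ⟨z - lastJump (N · ω),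
      ⟨tsub_le_tsub_right hxz _, tsub_le_tsub_right hz.1.1 _⟩, ?_⟩
    rw [← resetProcess_eq_of_lastJump_le (W := W) hn hc hTz hz.1.1]
    exact hz.1.2
  · rintro ⟨t, ⟨hxt, ht⟩, ht0⟩
    have htT1 : t + lastJump (N · ω) ≤ 1 := (le_tsub_iff_right hT1).1 ht
    refine (tsub_le_iff_right.1 hxt).trans (hz.2 ⟨htT1, ?_⟩)
    rwa [resetProcess_eq_of_lastJump_le hn hc le_add_self htT1, add_tsub_cancel_right]

variable [MeasurableSpace Ω] {P : Measure Ω} {r : ℝ≥0}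

lemma IsPoissonProcess.ae_lastJump_lt_one (hN : IsPoissonProcess N r P) :
    ∀ᵐ ω ∂P, lastJump (N · ω) < 1 := by
  have h := (hN.hasLaw_lastJump.ae_iff measurableSet_Ico.mem).2
    (ae_bind_of_discrete measurableSet_Ico ae_mem_Ico_maxUniformMeasure)
  exact h.mono fun ω hω ↦ NNReal.coe_lt_one.1 hω.2

namespace IsResettingModel

lemma le_lastZero_ae_eq_approachesZeroOn (hM : IsResettingModel W N r P) (x : ℝ≥0) :
    {ω | (x : ℝ) ≤ lastZero (resetProcess W N) ω} =ᵐ[P] {ω | ApproachesZeroOn (W (N 1 ω) · ω)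
      (x - lastJump (N · ω)) (1 - lastJump (N · ω))} := by
  filter_upwards [hM.poisson.mono, hM.poisson.rightCont, hM.poisson.ae_lastJump_lt_one,
    ae_all_iff.2 fun k ↦ (hM.brownian k).cont,
    ae_all_iff.2 fun k ↦ (hM.brownian k).eval_zero_ae_eq_zero] with ω hn hc hT hw h0
  exact propext ((le_lastZero_resetProcess_iff hn hc (hw _) (h0 _)).trans
    (approachesZeroOn_iff_exists (hw _) (tsub_pos_of_lt hT).ne').symm)

lemma measurable_paths (hM : IsResettingModel W N r P) :
    Measurable (fun ω k t ↦ W k t ω) ∧ Measurable (fun ω t ↦ N t ω) :=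
  ⟨measurable_pi_lambda _ fun k ↦ measurable_pi_lambda _ (hM.measurable k),
    measurable_pi_lambda _ hM.poisson.measurable⟩

lemma nullMeasurableSet_le_lastZero (hM : IsResettingModel W N r P) (x : ℝ≥0) :
    NullMeasurableSet {ω | (x : ℝ) ≤ lastZero (resetProcess W N) ω} P :=
  ((hM.measurable_paths.1.prodMk hM.measurable_paths.2)
    (measurableSet_approachesZeroOn_after_lastJump x)).nullMeasurableSet.congr
      (hM.le_lastZero_ae_eq_approachesZeroOn x).symm

lemma aemeasurable_lastZero (hM : IsResettingModel W N r P) :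
    AEMeasurable (lastZero (resetProcess W N)) P := by
  refine NullMeasurable.aemeasurable (measurable_of_Ici fun x ↦ ?_)
  rcases le_total x 0 with hx | hx
  · convert! MeasurableSet.univ
    exact Set.eq_univ_of_forall fun ω ↦ hx.trans (lastZero_mem_Icc _ ω).1
  · exact hM.nullMeasurableSet_le_lastZero ⟨x, hx⟩

lemma measure_le_lastZero (hM : IsResettingModel W N r P) {x : ℝ≥0} (hx : x ≤ 1) :
    P {ω | (x : ℝ) ≤ lastZero (resetProcess W N) ω} =
      ∫⁻ ω, arcsineMeasure (lastJump (N · ω)) 1 (Set.Ici x) ∂P := by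
  have := hM.poisson.isProbabilityMeasure
  rw [measure_congr (hM.le_lastZero_ae_eq_approachesZeroOn x),
    measure_of_indepFun_eq_lintegral (p := fun w n ↦ ApproachesZeroOn (w (n 1)) (x - lastJump n)
      (1 - lastJump n)) hM.indep hM.measurable_paths.1 hM.measurable_paths.2
      (measurableSet_approachesZeroOn_after_lastJump x)]
  refine lintegral_congr_ae ?_
  filter_upwards [hM.poisson.ae_lastJump_lt_one] with ω hT
  rw [measure_approachesZeroOn (hM.brownian _) (hM.measurable _) (tsub_le_tsub_right hx _)
    (tsub_pos_of_lt hT).ne', arcsineMeasure_Ici (NNReal.coe_lt_one.2 hT) (NNReal.coe_le_one.2 hx),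
    NNReal.coe_sub hT.le, NNReal.coe_one]
  rcases le_total x (lastJump (N · ω)) with h | h
  · rw [tsub_eq_zero_of_le h, NNReal.coe_zero, zero_div, Real.sqrt_zero, Real.sqrt_eq_zero'.2
      (div_nonpos_of_nonpos_of_nonneg (sub_nonpos.2 (NNReal.coe_le_coe.2 h))
        (sub_nonneg.2 (NNReal.coe_le_one.2 hT.le)))]
  · rw [NNReal.coe_sub h]

end IsResettingModel

end LastZero

section Law

/-- The law of the last zero on `[0, 1]` of Brownian motion under resetting with intensity `r`: the
mixture over a Poisson number `j` of resets of the beta distributions with parameters `j + 1 / 2`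
and `1 / 2`. -/
noncomputable def lastZeroLaw (r : ℝ≥0) : Measure ℝ :=
  (poissonMeasure r).bind fun j ↦ betaMeasure (j + 1 / 2) (1 / 2)

lemma isProbabilityMeasure_lastZeroLaw (r : ℝ≥0) : IsProbabilityMeasure (lastZeroLaw r) :=
  isProbabilityMeasure_bind .of_discrete <| ae_of_all _ fun _ ↦
    isProbabilityMeasureBeta (by positivity) one_half_pos

lemma ae_mem_Icc_lastZeroLaw (r : ℝ≥0) : ∀ᵐ y ∂lastZeroLaw r, y ∈ Set.Icc (0 : ℝ) 1 :=
  ae_bind_of_discrete measurableSet_Icc fun _ ↦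
    (ae_mem_Ioo_betaMeasure _ _).mono fun _ hy ↦ Set.Ioo_subset_Icc_self hy

variable {Ω : Type*} [MeasurableSpace Ω] {P : Measure Ω} {W : ℕ → ℝ≥0 → Ω → ℝ}
  {N : ℝ≥0 → Ω → ℕ} {r : ℝ≥0}

namespace IsResettingModel

lemma map_lastZero_Ici (hM : IsResettingModel W N r P) {x : ℝ≥0} (hx : x ≤ 1) :
    P.map (lastZero (resetProcess W N)) (Set.Ici x) = lastZeroLaw r (Set.Ici x) := by
  have hmeas : Measurable fun a ↦ arcsineMeasure a 1 (Set.Ici x) :=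
    (Measure.measurable_coe measurableSet_Ici).comp (measurable_arcsineMeasure 1)
  calc P.map (lastZero (resetProcess W N)) (Set.Ici x)
      = P {ω | (x : ℝ) ≤ lastZero (resetProcess W N) ω} :=
        Measure.map_apply_of_aemeasurable hM.aemeasurable_lastZero measurableSet_Ici
    _ = ∫⁻ ω, arcsineMeasure (lastJump (N · ω)) 1 (Set.Ici x) ∂P := hM.measure_le_lastZero hx
    _ = ∫⁻ a, arcsineMeasure a 1 (Set.Ici x) ∂(poissonMeasure r).bind maxUniformMeasure :=
        hM.poisson.hasLaw_lastJump.lintegral_comp hmeas.aemeasurable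
    _ = ((poissonMeasure r).bind maxUniformMeasure).bind (arcsineMeasure · 1) (Set.Ici x) :=
        (Measure.bind_apply measurableSet_Ici (measurable_arcsineMeasure 1).aemeasurable).symm
    _ = lastZeroLaw r (Set.Ici x) := by
        rw [Measure.bind_bind .of_discrete (measurable_arcsineMeasure 1).aemeasurable]
        simp_rw [bind_maxUniformMeasure_arcsineMeasure]
        rfl

theorem hasLaw_lastZero (hM : IsResettingModel W N r P) :
    HasLaw (lastZero (resetProcess W N)) (lastZeroLaw r) P where
  aemeasurable := hM.aemeasurable_lastZero
  map_eq := by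
    have := hM.poisson.isProbabilityMeasure
    have := Measure.isProbabilityMeasure_map hM.aemeasurable_lastZero
    refine ext_of_Ici_of_ae_mem_Icc ((ae_map_iff hM.aemeasurable_lastZero measurableSet_Icc).2
      (ae_of_all _ (lastZero_mem_Icc _))) (ae_mem_Icc_lastZeroLaw r) ?_
    rintro x ⟨hx0, hx1⟩
    lift x to ℝ≥0 using hx0
    exact hM.map_lastZero_Ici (NNReal.coe_le_one.1 hx1)

end IsResettingModel

end Law

section Moments

lemma hasSum_integral_bind_poissonMeasure {α : Type*} [MeasurableSpace α] {r : ℝ≥0}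
    {μ : ℕ → Measure α} {f : α → ℝ} (hf : Integrable f ((poissonMeasure r).bind μ)) :
    HasSum (fun j ↦ Real.exp (-r) * r ^ j / j.factorial * ∫ y, f y ∂μ j)
      (∫ y, f y ∂(poissonMeasure r).bind μ) := by
  have hbind : (poissonMeasure r).bind μ =
      (Kernel.ofFunOfCountable μ ∘ₖ Kernel.const Unit (poissonMeasure r)) () :=
    Measure.comp_eq_comp_const_apply (μ := poissonMeasure r) (κ := .ofFunOfCountable μ)
  rw [hbind] at hf ⊢
  rw [Kernel.integral_comp hf]
  exact hasSum_integral_poissonMeasure hf.integral_comp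

lemma integrable_pow_lastZeroLaw (r : ℝ≥0) (n : ℕ) :
    Integrable (fun y ↦ y ^ n) (lastZeroLaw r) := by
  have := isProbabilityMeasure_lastZeroLaw r
  refine .of_bound (by fun_prop) 1 ((ae_mem_Icc_lastZeroLaw r).mono fun y hy ↦ ?_)
  rw [Real.norm_of_nonneg (pow_nonneg hy.1 n)]
  exact pow_le_one₀ hy.1 hy.2

lemma hasSum_integral_pow_lastZeroLaw (r : ℝ≥0) (n : ℕ) :
    HasSum (fun j : ℕ ↦ (r : ℝ) ^ j *
        (Real.Gamma (j + 1 / 2 + n) / (Real.Gamma (j + 1 / 2) * (j + n).factorial)))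
      (Real.exp r * ∫ y, y ^ n ∂lastZeroLaw r) := by
  have h := (hasSum_integral_bind_poissonMeasure (integrable_pow_lastZeroLaw r n)).mul_left
    (Real.exp r)
  convert! h using 1
  ext j
  rw [integral_pow_betaMeasure (by positivity) one_half_pos, beta, beta,
    show (j + 1 / 2 + 1 / 2 : ℝ) = j + 1 by ring,
    show (j + 1 / 2 + n + 1 / 2 : ℝ) = (j + n : ℕ) + 1 by push_cast; ring,
    Real.Gamma_nat_eq_factorial, Real.Gamma_nat_eq_factorial, Real.exp_neg]
  have := (Real.Gamma_pos_of_pos one_half_pos).ne'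
  have := (Real.Gamma_pos_of_pos (show (0 : ℝ) < j + 1 / 2 by positivity)).ne'
  field_simp

lemma Gamma_mul_regularizedHGFunCoeff {a : ℂ} (ha : ∀ m : ℕ, a ≠ -m) (b c : ℂ) (k : ℕ) :
    Complex.Gamma a * Complex.regularizedHGFunCoeff {1, a} {b, c} k =
      Complex.Gamma (a + k) / (Complex.Gamma (b + k) * Complex.Gamma (c + k)) := by
  have hk : (k.factorial : ℂ) ≠ 0 := Nat.cast_ne_zero.2 k.factorial_ne_zero
  have hpoch : Complex.Gamma (a + k) = Complex.Gamma a * (ascPochhammer ℂ k).eval a := by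
    rw [← Complex.Gamma_add_nat_div_Gamma_eq a ha, mul_div_cancel₀ _ (Complex.Gamma_ne_zero ha)]
  simp only [Complex.regularizedHGFunCoeff, Multiset.insert_eq_cons, Multiset.map_cons,
    Multiset.map_singleton, Multiset.prod_cons, Multiset.prod_singleton, ascPochhammer_eval_one]
  rw [hpoch, mul_div_mul_left _ _ hk, mul_div_assoc]

lemma regularizedHGFun_eq_tsum (a b : Multiset ℂ) (z : ℂ) :
    Complex.regularizedHGFun a b z = ∑' k, Complex.regularizedHGFunCoeff a b k * z ^ k := by
  rw [Complex.regularizedHGFun, FormalMultilinearSeries.sum]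
  refine tsum_congr fun k ↦ ?_
  rw [Complex.regularizedHGFunSeries, FormalMultilinearSeries.ofScalars_apply_eq, smul_eq_mul]

theorem integral_pow_lastZeroLaw (r : ℝ≥0) (n : ℕ) :
    ((∫ y, y ^ n ∂lastZeroLaw r : ℝ) : ℂ) =
      (Real.exp (-r) : ℂ) *
        ((Real.Gamma (1 / 2 + n) / (√Real.pi * Real.Gamma (1 + n)) : ℝ)
          + ((r : ℝ) * Real.Gamma (3 / 2 + n) : ℝ) *
            Complex.regularizedHGFun {1, 3 / 2 + (n : ℂ)} {3 / 2, 2 + (n : ℂ)} ((r : ℝ) : ℂ)) := by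
  have hsum := hasSum_integral_pow_lastZeroLaw r n
  have hint : ∫ y, y ^ n ∂lastZeroLaw r = Real.exp (-r) *
      (Real.exp r * ∫ y, y ^ n ∂lastZeroLaw r) := by
    rw [← mul_assoc, ← Real.exp_add, neg_add_cancel, Real.exp_zero, one_mul]
  have hne : ∀ m : ℕ, (3 / 2 + n : ℂ) ≠ -m := by
    intro m h
    have : (3 / 2 + n : ℝ) = -m := by simpa using congrArg Complex.re h
    linarith [m.cast_nonneg (α := ℝ), n.cast_nonneg (α := ℝ)]
  rw [hint, ← hsum.tsum_eq, hsum.summable.tsum_eq_zero_add, Complex.ofReal_mul,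
    Complex.ofReal_add, Complex.ofReal_tsum, regularizedHGFun_eq_tsum, ← tsum_mul_left]
  congr 2
  · rw [pow_zero, one_mul, Nat.cast_zero, zero_add, zero_add, Real.Gamma_one_half_eq,
      add_comm (1 : ℝ), Real.Gamma_nat_eq_factorial]
  · refine tsum_congr fun k ↦ ?_
    have hfactorial : Complex.Gamma (2 + n + k) = (k + 1 + n).factorial := by
      rw [← Complex.Gamma_nat_eq_factorial]
      push_cast
      ring_nf
    have hcoeff := Gamma_mul_regularizedHGFunCoeff hne (3 / 2) (2 + n) k
    rw [hfactorial] at hcoeff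
    push_cast [← Complex.Gamma_ofReal]
    rw [show ∀ A B C D : ℂ, A * B * (C * D) = A * D * (B * C) by intros; ring, hcoeff, pow_succ']
    ring_nf

end Moments

section MeanAndVariance

lemma hasSum_pow_div_factorial_add {r : ℝ} (hr : r ≠ 0) (m : ℕ) :
    HasSum (fun j : ℕ ↦ r ^ j / (j + m).factorial)
      ((Real.exp r - ∑ i ∈ Finset.range m, r ^ i / i.factorial) / r ^ m) := by
  have hexp := NormedSpace.expSeries_div_hasSum_exp (𝔸 := ℝ) r
  rw [← Real.exp_eq_exp_ℝ] at hexp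
  convert! ((hasSum_nat_add_iff' m).2 hexp).div_const (r ^ m) using 2 with j
  rw [pow_add]
  field_simp

lemma integral_lastZeroLaw {r : ℝ≥0} (hr : r ≠ 0) :
    ∫ y, y ∂lastZeroLaw r = 1 + (Real.exp (-r) - 1) / (2 * r) := by
  have hr' : (r : ℝ) ≠ 0 := NNReal.coe_ne_zero.2 hr
  have hcoeff (j : ℕ) : (r : ℝ) ^ j *
      (Real.Gamma (j + 1 / 2 + (1 : ℕ)) / (Real.Gamma (j + 1 / 2) * (j + 1).factorial)) =
      r ^ j / (j + 0).factorial - 1 / 2 * (r ^ j / (j + 1).factorial) := by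
    rw [Nat.cast_one, Real.Gamma_add_one (by positivity), add_zero, Nat.factorial_succ]
    push_cast
    field_simp
    ring
  have hsum := (hasSum_pow_div_factorial_add hr' 0).sub
    ((hasSum_pow_div_factorial_add hr' 1).mul_left (1 / 2))
  have hmean := hasSum_integral_pow_lastZeroLaw r 1
  rw [funext hcoeff] at hmean
  replace hmean := hmean.unique hsum
  simp only [pow_one, Finset.sum_range_zero, Finset.sum_range_one, pow_zero,
    Nat.factorial_zero, Nat.cast_one, sub_zero, div_one] at hmean
  rw [Real.exp_neg, ← mul_right_inj' (Real.exp_ne_zero r), hmean]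
  field_simp
  ring

lemma integral_sq_lastZeroLaw {r : ℝ≥0} (hr : r ≠ 0) :
    ∫ y, y ^ 2 ∂lastZeroLaw r = 1 - 1 / r + 3 / (4 * (r : ℝ) ^ 2) +
      Real.exp (-r) * (1 / (4 * r) - 3 / (4 * (r : ℝ) ^ 2)) := by
  have hr' : (r : ℝ) ≠ 0 := NNReal.coe_ne_zero.2 hr
  have hcoeff (j : ℕ) : (r : ℝ) ^ j *
      (Real.Gamma (j + 1 / 2 + (2 : ℕ)) / (Real.Gamma (j + 1 / 2) * (j + 2).factorial)) =
      r ^ j / (j + 0).factorial - r ^ j / (j + 1).factorial +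
        3 / 4 * (r ^ j / (j + 2).factorial) := by
    rw [show (j + 1 / 2 + (2 : ℕ) : ℝ) = j + 1 / 2 + 1 + 1 by push_cast; ring,
      Real.Gamma_add_one (by positivity), Real.Gamma_add_one (by positivity), add_zero,
      Nat.factorial_succ (j + 1), Nat.factorial_succ]
    push_cast
    field_simp
    ring
  have hsum := ((hasSum_pow_div_factorial_add hr' 0).sub (hasSum_pow_div_factorial_add hr' 1)).add
    ((hasSum_pow_div_factorial_add hr' 2).mul_left (3 / 4))
  have hsq := hasSum_integral_pow_lastZeroLaw r 2
  rw [funext hcoeff] at hsq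
  replace hsq := hsq.unique hsum
  simp only [Finset.sum_range_succ, Finset.sum_range_zero, zero_add, pow_zero, pow_one,
    Nat.factorial_zero, Nat.factorial_one, Nat.cast_one, sub_zero, div_one] at hsq
  rw [Real.exp_neg, ← mul_right_inj' (Real.exp_ne_zero r), hsq]
  field_simp
  ring

lemma integral_sq_sub_sq_integral_lastZeroLaw {r : ℝ≥0} (hr : r ≠ 0) :
    ∫ y, y ^ 2 ∂lastZeroLaw r - (∫ y, y ∂lastZeroLaw r) ^ 2 =
      (2 - Real.exp (-r) * (1 + 3 * r) - Real.exp (-(2 * r))) / (4 * (r : ℝ) ^ 2) := by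
  have hr' : (r : ℝ) ≠ 0 := NNReal.coe_ne_zero.2 hr
  rw [integral_sq_lastZeroLaw hr, integral_lastZeroLaw hr, two_mul (r : ℝ), neg_add, Real.exp_add]
  field_simp
  ring

end MeanAndVariance

namespace IsResettingModel

variable {Ω : Type*} [MeasurableSpace Ω] {P : Measure Ω} {W : ℕ → ℝ≥0 → Ω → ℝ}
  {N : ℝ≥0 → Ω → ℕ} {r : ℝ≥0}

lemma integrable_lastZero_pow (hM : IsResettingModel W N r P) (n : ℕ) :
    Integrable (fun ω ↦ lastZero (resetProcess W N) ω ^ n) P :=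
  (hM.hasLaw_lastZero.map_eq ▸ integrable_pow_lastZeroLaw r n).comp_aemeasurable
    hM.aemeasurable_lastZero

lemma integral_lastZero_pow (hM : IsResettingModel W N r P) (n : ℕ) :
    ∫ ω, lastZero (resetProcess W N) ω ^ n ∂P = ∫ y, y ^ n ∂lastZeroLaw r :=
  hM.hasLaw_lastZero.integral_comp (f := fun y ↦ y ^ n) (by fun_prop)

lemma integrable_lastZero (hM : IsResettingModel W N r P) :
    Integrable (lastZero (resetProcess W N)) P := by
  simpa only [pow_one] using hM.integrable_lastZero_pow 1

lemma integral_lastZero (hM : IsResettingModel W N r P) (hr : r ≠ 0) :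
    ∫ ω, lastZero (resetProcess W N) ω ∂P = 1 + (Real.exp (-r) - 1) / (2 * r) :=
  hM.hasLaw_lastZero.integral_eq.trans (integral_lastZeroLaw hr)

lemma variance_lastZero_eq_sub (hM : IsResettingModel W N r P) :
    variance (lastZero (resetProcess W N)) P =
      ∫ ω, lastZero (resetProcess W N) ω ^ 2 ∂P -
        (∫ ω, lastZero (resetProcess W N) ω ∂P) ^ 2 := by
  have := hM.poisson.isProbabilityMeasure
  exact variance_eq_sub ((memLp_two_iff_integrable_sq
    hM.aemeasurable_lastZero.aestronglyMeasurable).2 (hM.integrable_lastZero_pow 2))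

lemma integral_lastZero_sq_sub_sq_integral (hM : IsResettingModel W N r P) (hr : r ≠ 0) :
    ∫ ω, lastZero (resetProcess W N) ω ^ 2 ∂P -
        (∫ ω, lastZero (resetProcess W N) ω ∂P) ^ 2 =
      (2 - Real.exp (-r) * (1 + 3 * r) - Real.exp (-(2 * r))) / (4 * (r : ℝ) ^ 2) := by
  rw [hM.integral_lastZero_pow, hM.hasLaw_lastZero.integral_eq]
  exact integral_sq_sub_sq_integral_lastZeroLaw hr

end IsResettingModel

section Limits

lemma tendsto_mean_nhdsGT_zero :
    Tendsto (fun r : ℝ ↦ 1 + (Real.exp (-r) - 1) / (2 * r)) (𝓝[>] 0) (𝓝 (1 / 2)) := by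
  have hderiv : HasDerivAt (fun x : ℝ ↦ Real.exp (-x)) (-1) 0 := by
    simpa using (hasDerivAt_neg (0 : ℝ)).exp
  have hslope := (hasDerivAt_iff_tendsto_slope.1 hderiv).mono_left (nhdsGT_le_nhdsNE 0)
  have hlim := (hslope.const_mul (1 / 2)).const_add 1
  rw [show (1 : ℝ) + 1 / 2 * -1 = 1 / 2 by norm_num] at hlim
  refine hlim.congr fun r ↦ ?_
  rw [slope_def_field, neg_zero, Real.exp_zero, sub_zero, div_mul_div_comm, one_mul]

lemma tendsto_mean_atTop :
    Tendsto (fun r : ℝ ↦ 1 + (Real.exp (-r) - 1) / (2 * r)) atTop (𝓝 1) := by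
  have hlim := ((Real.tendsto_exp_neg_atTop_nhds_zero.sub_const 1).div_atTop
    (tendsto_id.const_mul_atTop two_pos)).const_add 1
  simpa only [add_zero, id_eq] using hlim

lemma tendsto_variance_atTop :
    Tendsto (fun r : ℝ ↦ (2 - Real.exp (-r) * (1 + 3 * r) - Real.exp (-(2 * r))) / (4 * r ^ 2))
      atTop (𝓝 0) := by
  have hexp := Real.tendsto_exp_neg_atTop_nhds_zero
  have hmul_exp : Tendsto (fun r : ℝ ↦ Real.exp (-r) * (1 + 3 * r)) atTop (𝓝 (0 + 3 * 0)) :=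
    (hexp.add ((Real.tendsto_pow_mul_exp_neg_atTop_nhds_zero 1).const_mul 3)).congr fun r ↦ by ring
  have hexp_two : Tendsto (fun r : ℝ ↦ Real.exp (-(2 * r))) atTop (𝓝 0) :=
    hexp.comp (tendsto_id.const_mul_atTop two_pos)
  exact ((hmul_exp.const_sub 2).sub hexp_two).div_atTop
    ((tendsto_pow_atTop two_ne_zero).const_mul_atTop four_pos)

lemma measure_le_abs_sub_le_of_ae_le {Ω : Type*} [MeasurableSpace Ω] {P : Measure Ω}
    [IsProbabilityMeasure P] {X : Ω → ℝ} {c ε : ℝ} (hX : Integrable X P) (hle : ∀ᵐ ω ∂P, X ω ≤ c)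
    (hε : 0 < ε) : P {ω | ε ≤ |X ω - c|} ≤ ENNReal.ofReal ((c - ∫ ω, X ω ∂P) / ε) := by
  have habs : (fun ω ↦ |X ω - c|) =ᵐ[P] fun ω ↦ c - X ω := 
    hle.mono fun ω hω ↦ (abs_sub_comm _ _).trans (abs_of_nonneg (sub_nonneg.2 hω))
  have hmarkov := mul_meas_ge_le_integral_of_nonneg (ae_of_all P fun ω ↦ abs_nonneg (X ω - c))
    (hX.sub (integrable_const c)).abs ε
  rw [integral_congr_ae habs, integral_sub (integrable_const c) hX, integral_const,
    probReal_univ, one_smul] at hmarkov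
  rw [← ofReal_measureReal]
  exact ENNReal.ofReal_le_ofReal ((le_div_iff₀' hε).2 hmarkov)

lemma tendsto_measure_le_abs_sub_of_tendsto_integral {ι : Type*} {l : Filter ι} {Ω : ι → Type*}
    [∀ i, MeasurableSpace (Ω i)] {P : ∀ i, Measure (Ω i)} {X : ∀ i, Ω i → ℝ} {c ε : ℝ}
    (hP : ∀ᶠ i in l, IsProbabilityMeasure (P i)) (hX : ∀ᶠ i in l, Integrable (X i) (P i))
    (hle : ∀ᶠ i in l, ∀ᵐ ω ∂P i, X i ω ≤ c)
    (hlim : Tendsto (fun i ↦ ∫ ω, X i ω ∂P i) l (𝓝 c)) (hε : 0 < ε) :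
    Tendsto (fun i ↦ P i {ω | ε ≤ |X i ω - c|}) l (𝓝 0) := by
  have hbound := ENNReal.tendsto_ofReal ((hlim.const_sub c).div_const ε)
  rw [sub_self, zero_div, ENNReal.ofReal_zero] at hbound
  refine tendsto_of_tendsto_of_tendsto_of_le_of_le' tendsto_const_nhds hbound
    (Eventually.of_forall fun _ ↦ zero_le) ?_
  filter_upwards [hP, hX, hle] with i _ hXi hlei using measure_le_abs_sub_le_of_ae_le hXi hlei hε

lemma tendsto_coe_nhdsGT_zero : Tendsto ((↑) : ℝ≥0 → ℝ) (𝓝[>] 0) (𝓝[>] 0) :=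
  NNReal.continuous_coe.continuousWithinAt.tendsto_nhdsWithin fun _ ↦ NNReal.coe_pos.2

end Limits

end BrownianResetting

theorem mainTheorem5 :
    -- moments, mean and variance, for each fixed intensity
    (∀ {Ω : Type*} [MeasurableSpace Ω] (P : Measure Ω) (r : ℝ≥0) (W : ℕ → ℝ≥0 → Ω → ℝ)
      (N : ℝ≥0 → Ω → ℕ), 0 < r → BrownianResetting.IsResettingModel W N r P →
      ∀ L : Ω → ℝ, L = BrownianResetting.lastZero (BrownianResetting.resetProcess W N) →
      (∀ n : ℕ, Integrable (fun ω ↦ L ω ^ n) P ∧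
        ((∫ ω, L ω ^ n ∂P : ℝ) : ℂ) =
          (Real.exp (-r) : ℂ) *
            ((Real.Gamma (1 / 2 + n) / (√Real.pi * Real.Gamma (1 + n)) : ℝ)
              + ((r : ℝ) * Real.Gamma (3 / 2 + n) : ℝ) *
                Complex.regularizedHGFun {1, 3 / 2 + (n : ℂ)} {3 / 2, 2 + (n : ℂ)}
                  ((r : ℝ) : ℂ))) ∧
      Integrable L P ∧
      ∫ ω, L ω ∂P = 1 + (Real.exp (-r) - 1) / (2 * r) ∧
      variance L P = ∫ ω, L ω ^ 2 ∂P - (∫ ω, L ω ∂P) ^ 2 ∧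
      ∫ ω, L ω ^ 2 ∂P - (∫ ω, L ω ∂P) ^ 2 =
        (2 - Real.exp (-r) * (1 + 3 * r) - Real.exp (-(2 * r))) / (4 * (r : ℝ) ^ 2)) ∧
    -- limits in the intensity; the spaces may depend on the intensity
    (∀ {Ω : ℝ≥0 → Type*} [∀ r, MeasurableSpace (Ω r)] (P : ∀ r, Measure (Ω r))
      (W : ∀ r, ℕ → ℝ≥0 → Ω r → ℝ) (N : ∀ r, ℝ≥0 → Ω r → ℕ),
      (∀ r : ℝ≥0, 0 < r → BrownianResetting.IsResettingModel (W r) (N r) r (P r)) →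
      ∀ L : ∀ r, Ω r → ℝ,
      (∀ r, L r = BrownianResetting.lastZero (BrownianResetting.resetProcess (W r) (N r))) →
      Tendsto (fun r ↦ ∫ ω, L r ω ∂(P r)) (𝓝[>] 0) (𝓝 (1 / 2)) ∧
      Tendsto (fun r ↦ ∫ ω, L r ω ∂(P r)) atTop (𝓝 1) ∧
      Tendsto (fun r ↦ variance (L r) (P r)) atTop (𝓝 0) ∧
      ∀ ε : ℝ, 0 < ε → Tendsto (fun r ↦ P r {ω | ε ≤ |L r ω - 1|}) atTop (𝓝 0)) := by
  refine ⟨?_, ?_⟩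
  · rintro Ω _ P r W N hr hM L rfl
    refine ⟨fun n ↦ ⟨hM.integrable_lastZero_pow n, ?_⟩, hM.integrable_lastZero,
      hM.integral_lastZero hr.ne', hM.variance_lastZero_eq_sub,
      hM.integral_lastZero_sq_sub_sq_integral hr.ne'⟩
    rw [hM.integral_lastZero_pow]
    exact BrownianResetting.integral_pow_lastZeroLaw r n
  · intro Ω _ P W N hM L hL
    obtain rfl := funext hL
    have hpos := eventually_gt_atTop (0 : ℝ≥0)
    have hcoe := NNReal.tendsto_coe_atTop.2 tendsto_id
    have hmean_atTop := (BrownianResetting.tendsto_mean_atTop.comp hcoe).congr'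
      (hpos.mono fun r hr ↦ ((hM r hr).integral_lastZero hr.ne').symm)
    refine ⟨?_, hmean_atTop, ?_, fun ε hε ↦ ?_⟩
    · exact (BrownianResetting.tendsto_mean_nhdsGT_zero.comp
        BrownianResetting.tendsto_coe_nhdsGT_zero).congr'
        (eventually_mem_nhdsWithin.mono fun r hr ↦ ((hM r hr).integral_lastZero hr.ne').symm)
    · exact (BrownianResetting.tendsto_variance_atTop.comp hcoe).congr' (hpos.mono fun r hr ↦
        ((hM r hr).variance_lastZero_eq_sub.trans
          ((hM r hr).integral_lastZero_sq_sub_sq_integral hr.ne')).symm)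
    · exact BrownianResetting.tendsto_measure_le_abs_sub_of_tendsto_integral
        (hpos.mono fun r hr ↦ (hM r hr).poisson.isProbabilityMeasure)
        (hpos.mono fun r hr ↦ (hM r hr).integrable_lastZero)
        (Eventually.of_forall fun r ↦ ae_of_all _ fun ω ↦
          (BrownianResetting.lastZero_mem_Icc _ ω).2) hmean_atTop hε
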